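/- Let $W$ be a standard Brownian motion on a probability space $(\Omega,\mathcal F,P)$, let $\sigma,\gamma,\kappa,T>0$ and $c\in\mathbb R$, and put $\beta=\gamma^2/(2\kappa\sigma^2)$. For $x\in\mathbb R$ and $t\ge 0$ let $$L^x_t(W)=\lim_{\varepsilon\downarrow0}\frac1\varepsilon\int_0^t \mathbf 1_{[x,x+\varepsilon]}(W_r)\,dr\qquad P\text{-a.s.}$$ be the local time of $W$ at level $x$, and let $$U(t,z)=\frac1\beta\log E\Big[\exp\Big(\beta\sigma L_t^{(z-c)/\sigma}(W)\Big)\Big],\qquad z\ge c.$$ Then, for all $(t,z)\in(0,T]\times[c,\infty)$, the limit defining $L_t^{(z-c)/\sigma}(W)$ exists $P$-a.s., the expectation is finite, and $$U(t,z)=\frac1\beta\log\Bigg(\mathrm{erf}\Big(\frac{z-c}{\sigma\sqrt{2t}}\Big)+e^{-\beta(z-c)+\beta^2\sigma^2t/2}\bigg[1-\mathrm{erf}\Big(\frac{z-c}{\sigma\sqrt{2t}}-\frac{\beta\sigma\sqrt t}{\sqrt2}\Big)\bigg]\Bigg),$$ where $\mathrm{erf}(x)=\frac2{\sqrt\pi}\int_0^xe^{-y^2}\,dy$.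 Moreover $U$ belongs to $\mathcal C^{1,2}((0,T]\times[c,\infty))$ and satisfies the partial differential equation $$\partial_tU(t,z)=\frac{\sigma^2}2\,\partial_{zz}U(t,z)+\frac{\gamma^2}{4\kappa}\big(\partial_zU(t,z)\big)^2\qquad\text{for all }(t,z)\in(0,T]\times[c,\infty),$$ with the boundary condition $$\partial_zU(t,c)=-1\qquad\text{for all }t\in(0,T],$$ where the $z$-derivatives at $z=c$ are taken from the right. -/

import Mathlib

open Set Filter Topology MeasureTheory ProbabilityTheory
open scoped NNReal

namespace TargetZone

/-- The normalized occupation time `(1/ε) ∫₀ᵗ 1_{[x, x+ε]}(W_r) dr` of the path `r ↦ W r ω`. -/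
noncomputable def occupation {Ω : Type*} (W : ℝ≥0 → Ω → ℝ) (x t ε : ℝ) (ω : Ω) : ℝ :=
  ε⁻¹ * ∫ r in (0 : ℝ)..t, (Icc x (x + ε)).indicator (fun _ => (1 : ℝ)) (W r.toNNReal ω)

/-- The local time `L_t^x(W) = lim_{ε ↓ 0} (1/ε) ∫₀ᵗ 1_{[x, x+ε]}(W_r) d⟨W, W⟩_r` of a standard
Brownian motion `W` at level `x` (for which `d⟨W, W⟩_r = dr`), as a pathwise limit. -/
noncomputable def localTime {Ω : Type*} (W : ℝ≥0 → Ω → ℝ) (x t : ℝ) (ω : Ω) : ℝ :=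
  limUnder (𝓝[>] (0 : ℝ)) (fun ε => occupation W x t ε ω)

/-- The constant `β = γ² / (2 κ σ²)`. -/
noncomputable def beta (σ γ κ : ℝ) : ℝ := γ ^ 2 / (2 * κ * σ ^ 2)

/-- The function `U(t, z) = (1/β) log E[exp (β σ L_t^{(z-c)/σ}(W))]`. -/
noncomputable def U {Ω : Type*} [MeasurableSpace Ω] (P : Measure Ω) (W : ℝ≥0 → Ω → ℝ)
    (σ γ κ c : ℝ) (t z : ℝ) : ℝ :=
  1 / beta σ γ κ *
    Real.log (∫ ω, Real.exp (beta σ γ κ * σ * localTime W ((z - c) / σ) t ω) ∂P)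

/-- The Gaussian error function. -/
noncomputable def erf (x : ℝ) : ℝ :=
  2 / √Real.pi * ∫ y in (0 : ℝ)..x, Real.exp (-y ^ 2)

/-- The expression in terms of `erf` for `U`. -/
noncomputable def closedForm (σ γ κ c : ℝ) (t z : ℝ) : ℝ :=
  1 / beta σ γ κ *
    Real.log (erf ((z - c) / (σ * √(2 * t))) +
      Real.exp (-beta σ γ κ * (z - c) + beta σ γ κ ^ 2 * σ ^ 2 * t / 2) *
        (1 - erf ((z - c) / (σ * √(2 * t)) - beta σ γ κ * σ * √t / √2)))

/-- The time derivative `∂_t u(t, z)`. -/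
noncomputable def dt (u : ℝ → ℝ → ℝ) (t z : ℝ) : ℝ := deriv (fun s => u s z) t

/-- The space derivative `∂_z u(t, z)` on `[c, ∞)`, one-sided at `z = c`. -/
noncomputable def dz (c : ℝ) (u : ℝ → ℝ → ℝ) (t z : ℝ) : ℝ :=
  derivWithin (fun y => u t y) (Ici c) z

/-- The second space derivative `∂_zz u(t, z)` on `[c, ∞)`, one-sided at `z = c`. -/
noncomputable def dzz (c : ℝ) (u : ℝ → ℝ → ℝ) (t z : ℝ) : ℝ := dz c (dz c u) t z

/-- `u` is of class `C^{1,2}` on `(0, T] × [c, ∞)`: the derivatives `∂_t u`, `∂_z u`, `∂_zz u`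
exist there (in space one-sided at `z = c`), and they and `u` are jointly continuous. -/
structure IsC12 (T c : ℝ) (u : ℝ → ℝ → ℝ) : Prop where
  differentiable_t : ∀ t ∈ Ioc 0 T, ∀ z ∈ Ici c, DifferentiableAt ℝ (fun s => u s z) t
  differentiable_z : ∀ t ∈ Ioc 0 T, ∀ z ∈ Ici c,
    DifferentiableWithinAt ℝ (fun y => u t y) (Ici c) z
  differentiable_zz : ∀ t ∈ Ioc 0 T, ∀ z ∈ Ici c,
    DifferentiableWithinAt ℝ (fun y => dz c u t y) (Ici c) z
  continuous_u : ContinuousOn (fun p : ℝ × ℝ => u p.1 p.2) (Ioc 0 T ×ˢ Ici c)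
  continuous_t : ContinuousOn (fun p : ℝ × ℝ => dt u p.1 p.2) (Ioc 0 T ×ˢ Ici c)
  continuous_z : ContinuousOn (fun p : ℝ × ℝ => dz c u p.1 p.2) (Ioc 0 T ×ˢ Ici c)
  continuous_zz : ContinuousOn (fun p : ℝ × ℝ => dzz c u p.1 p.2) (Ioc 0 T ×ˢ Ici c)

end TargetZone

/-! The exponential moment is computed from all moments of the local time by Kac's recursion. For
bounded `V`, the moments `m_n(t, y)` of `∫₀ᵗ V (y + W_r) dr` satisfy `m_{n+1}(t, y) = (n+1) ∫₀ᵗ E[V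
(y + W_s) m_n(t - s, y + W_s)] ds` by the Markov property (`IsRegularBM.moment_succ`). With `V = ε⁻¹
1_{[0, ε]}` and `ε → 0` this becomes `M_{n+1}(t, a) = (n+1) ∫₀ᵗ p_s(a) M_n(t - s, 0) ds`, where `p`
is the heat kernel and `a` the distance to the level. The law with density `2 p_t(a + r)` on `r > 0`
and an atom of mass `erf (a / √(2t))` at `0` has moments solving this recursion, by a first passage
identity (`tailMoment_succ`). Since `p_s ≤ p_s(0)`, all approximating moments are at most `M_n(t,
0)`, so the exponential series passes to the limit and sums to the closed form
(`hasSum_limitMoment`).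

The pathwise limit comes from an L² bound: applied to the difference of two normalized indicators,
the recursion gives second moments of order `√|ε - δ|`. This yields almost sure convergence along
`(j + 1)⁻⁸`, and monotonicity of the unnormalized occupation time fills the gaps. Exponential
moments at `2θ`, bounded uniformly in `ε`, let the expectation follow the limit
(`integral_exp_localTime`).

Finally the exponential moment `F` solves `∂_t F = (σ²/2) ∂_zz F` with `∂_z F = -β F` at `z = c`.
The Cole–Hopf substitution `U = β⁻¹ log F` turns this into the stated equation and boundary
condition. -/

namespace TargetZone

/-! ### Kac's moment recursion for additive functionals of Brownian motion. -/

section markov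

/-- Fundamental theorem of calculus for powers of the tail integral of a bounded function. -/
lemma pow_succ_intervalIntegral {f : ℝ → ℝ} {t : ℝ} (hf : IntervalIntegrable f volume 0 t)
    (n : ℕ) :
    (∫ r in (0 : ℝ)..t, f r) ^ (n + 1) =
      (n + 1) * ∫ s in (0 : ℝ)..t, f s * (∫ r in s..t, f r) ^ n := by
  set J : ℝ → ℝ := fun s => ∫ r in t..s, f r with hJ
  -- `f` is only integrable (later it is an indicator along a path), so the chain rule for powers of
  -- `J` holds almost everywhere; absolute continuity allows it to be integrated back.
  have hac : AbsolutelyContinuousOnInterval J 0 t :=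
    hf.absolutelyContinuousOnInterval_intervalIntegral (c := t) right_mem_uIcc
  have hpow : ∀ m : ℕ, AbsolutelyContinuousOnInterval (fun s => J s ^ m) 0 t := by
    intro m
    induction m with
    | zero =>
      simp only [pow_zero]
      exact (LipschitzWith.const (1 : ℝ)).lipschitzOnWith.absolutelyContinuousOnInterval
    | succ m ih => simpa only [pow_succ] using ih.fun_mul hac
  have h1 := (hpow (n + 1)).integral_deriv_eq_sub
  have h2 : ∫ s in (0 : ℝ)..t, deriv (fun s => J s ^ (n + 1)) s =
      ∫ s in (0 : ℝ)..t, ((n : ℝ) + 1) * (J s ^ n * f s) := by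
    apply intervalIntegral.integral_congr_ae
    filter_upwards [hf.ae_hasDerivAt_integral] with x hx hxt
    have := (hx (uIoc_subset_uIcc hxt) t right_mem_uIcc).pow (n + 1)
    have hd : deriv (fun s => J s ^ (n + 1)) x = _ := this.deriv
    rw [hd]
    push_cast
    ring
  rw [h2] at h1
  have hJt : J t = 0 := by simp [hJ]
  have hs : ∀ s, ∫ r in s..t, f r = - J s := fun s => by
    rw [hJ, intervalIntegral.integral_symm]
  simp_rw [hs, ← intervalIntegral.integral_const_mul] at *
  rw [hJt, zero_pow (Nat.succ_ne_zero n), zero_sub] at h1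
  have h3 : ∀ s, ((n : ℝ) + 1) * (f s * (- J s) ^ n) =
      (-1) ^ n * (((n : ℝ) + 1) * (J s ^ n * f s)) := fun s => by
    rw [neg_pow (J s)]; ring
  simp_rw [h3, intervalIntegral.integral_const_mul] at *
  rw [h1, neg_pow (J 0)]
  ring

/-- Integration of a function of two independent variables. -/
lemma integral_of_indepFun {Ω α β : Type*} [MeasurableSpace Ω] [MeasurableSpace α]
    [MeasurableSpace β] {P : Measure Ω} [IsProbabilityMeasure P] {X : Ω → α} {Y : Ω → β}
    (hX : Measurable X) (hY : Measurable Y) (h : IndepFun X Y P) {F : α → β → ℝ}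
    (hF : Measurable (Function.uncurry F)) {C : ℝ} (hC : ∀ x y, |F x y| ≤ C) :
    ∫ ω, F (X ω) (Y ω) ∂P = ∫ x, ∫ ω, F x (Y ω) ∂P ∂(P.map X) := by
  have hprod := (indepFun_iff_map_prod_eq_prod_map_map hX.aemeasurable hY.aemeasurable).1 h
  have h1 : ∫ ω, F (X ω) (Y ω) ∂P = ∫ p, Function.uncurry F p ∂(P.map fun ω => (X ω, Y ω)) :=
    (integral_map (hX.prodMk hY).aemeasurable hF.stronglyMeasurable.aestronglyMeasurable).symm
  have : IsProbabilityMeasure (P.map X) := Measure.isProbabilityMeasure_map hX.aemeasurable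
  have : IsProbabilityMeasure (P.map Y) := Measure.isProbabilityMeasure_map hY.aemeasurable
  rw [h1, hprod, integral_prod]
  · refine integral_congr_ae (Eventually.of_forall fun x => ?_)
    exact integral_map hY.aemeasurable
      (hF.comp measurable_prodMk_left).stronglyMeasurable.aestronglyMeasurable
  · exact Integrable.of_bound hF.stronglyMeasurable.aestronglyMeasurable C
      (Eventually.of_forall fun p => hC p.1 p.2)

/-- Integration of a function of an independent variable and of `ω`. -/
lemma integral_of_indepFun_comap {Ω α β : Type*} [mΩ : MeasurableSpace Ω] [MeasurableSpace α]
    [mβ : MeasurableSpace β] {P : Measure Ω} [IsProbabilityMeasure P] {X : Ω → α} {Y : Ω → β}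
    (hX : Measurable X) (hY : Measurable Y) (h : IndepFun X Y P) {F : α → Ω → ℝ}
    (hF : Measurable[Prod.instMeasurableSpace (m₂ := mβ.comap Y)] (Function.uncurry F))
    {C : ℝ} (hC : ∀ x ω, |F x ω| ≤ C) :
    ∫ ω, F (X ω) ω ∂P = ∫ x, ∫ ω, F x ω ∂P ∂(P.map X) := by
  -- The identity, viewed as a map into `Ω` with the σ-algebra generated by `Y`, replaces `Y`: it
  -- generates the same σ-algebra, hence is independent of `X` as well.
  have hid : @Measurable Ω Ω mΩ (mβ.comap Y) id := measurable_id'' hY.comap_le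
  have hind : @IndepFun Ω α Ω mΩ _ (mβ.comap Y) X id P := by
    rw [IndepFun_iff_Indep] at h
    refine (@IndepFun_iff_Indep Ω α Ω mΩ _ (mβ.comap Y) X id P).2 ?_
    rwa [MeasurableSpace.comap_id]
  exact @integral_of_indepFun Ω α Ω mΩ _ (mβ.comap Y) P _ X id hX hid hind F hF C hC

/-- A Brownian motion all of whose paths are continuous and all of whose coordinates are
measurable. -/
structure IsRegularBM {Ω : Type*} [MeasurableSpace Ω] (W : ℝ≥0 → Ω → ℝ) (P : Measure Ω) : Prop
    extends IsPreBrownianReal W P where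
  continuous_path : ∀ ω, Continuous (W · ω)
  measurable_eval : ∀ t, Measurable (W t)

variable {Ω : Type*}

section paths_measurability

variable {V : ℝ → ℝ} {C : ℝ}

/-- The additive functional `∫₀ᵗ V (y + W_r) dr`. -/
noncomputable def additive {Ω : Type*} (V : ℝ → ℝ) (W : ℝ≥0 → Ω → ℝ) (t y : ℝ) (ω : Ω) : ℝ :=
  ∫ r in (0 : ℝ)..t, V (y + W r.toNNReal ω)

lemma measurable_uncurry_path {m : MeasurableSpace Ω} {W : ℝ≥0 → Ω → ℝ}
    (hc : ∀ ω, Continuous (W · ω)) (hm : ∀ t, Measurable[m] (W t)) :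
    Measurable (fun p : ℝ × Ω => W p.1.toNNReal p.2) := by
  have := measurable_uncurry_of_continuous_of_measurable (m := m) hc hm
  exact this.comp ((measurable_real_toNNReal.comp measurable_fst).prodMk measurable_snd)

/-- Joint measurability of `(s, t, y, ω) ↦ ∫ₛᵗ V (y + W_r) dr`. -/
lemma measurable_additive_aux {m : MeasurableSpace Ω} {W : ℝ≥0 → Ω → ℝ}
    (hc : ∀ ω, Continuous (W · ω)) (hm : ∀ t, Measurable[m] (W t)) (hV : Measurable V) :
    Measurable (fun p : (ℝ × ℝ) × (ℝ × Ω) =>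
      ∫ r in p.1.1..p.1.2, V (p.2.1 + W r.toNNReal p.2.2)) := by
  have hg : Measurable (fun q : ((ℝ × ℝ) × (ℝ × Ω)) × ℝ =>
      V (q.1.2.1 + W q.2.toNNReal q.1.2.2)) := by
    refine hV.comp ?_
    refine (measurable_fst.comp (measurable_snd.comp measurable_fst)).add ?_
    exact (measurable_uncurry_path hc hm).comp
      (measurable_snd.prodMk (measurable_snd.comp (measurable_snd.comp measurable_fst)))
  have hset : ∀ (a b : ((ℝ × ℝ) × (ℝ × Ω)) → ℝ), Measurable a → Measurable b →
      Measurable (fun p => ∫ r in Ioc (a p) (b p), V (p.2.1 + W r.toNNReal p.2.2)) := by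
    intro a b ha hb
    have hs : MeasurableSet {q : ((ℝ × ℝ) × (ℝ × Ω)) × ℝ | a q.1 < q.2 ∧ q.2 ≤ b q.1} :=
      (measurableSet_lt (ha.comp measurable_fst) measurable_snd).inter
        (measurableSet_le measurable_snd (hb.comp measurable_fst))
    have h2 := ((hg.indicator hs).stronglyMeasurable.integral_prod_right'
      (ν := volume)).measurable
    convert h2 using 2 with p
    rw [← integral_indicator measurableSet_Ioc]
    rfl
  simp only [intervalIntegral]
  exact (hset _ _ (measurable_fst.comp measurable_fst) (measurable_snd.comp measurable_fst)).sub
    (hset _ _ (measurable_snd.comp measurable_fst) (measurable_fst.comp measurable_fst))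

lemma measurable_additive {m : MeasurableSpace Ω} {W : ℝ≥0 → Ω → ℝ}
    (hc : ∀ ω, Continuous (W · ω)) (hm : ∀ t, Measurable[m] (W t)) (hV : Measurable V) :
    Measurable (fun p : (ℝ × ℝ) × Ω => additive V W p.1.1 p.1.2 p.2) := by
  have := measurable_additive_aux hc hm hV
  exact this.comp ((measurable_const.prodMk (measurable_fst.comp measurable_fst)).prodMk
    ((measurable_snd.comp measurable_fst).prodMk measurable_snd))

lemma abs_additive_le {W : ℝ≥0 → Ω → ℝ} (hC : ∀ x, |V x| ≤ C) {t : ℝ} (y : ℝ) (ω : Ω) :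
    |additive V W t y ω| ≤ C * |t| := by
  have := intervalIntegral.norm_integral_le_of_norm_le_const (a := 0) (b := t)
    (f := fun r => V (y + W r.toNNReal ω)) (C := C) fun x _ => hC _
  simpa [additive] using this

end paths_measurability

variable [MeasurableSpace Ω] {P : Measure Ω} {W : ℝ≥0 → Ω → ℝ}

lemma IsRegularBM.shift (hW : IsRegularBM W P) (s : ℝ≥0) :
    IsRegularBM (fun r ω => W (s + r) ω - W s ω) P where
  toIsPreBrownianReal := hW.toIsPreBrownianReal.shift s
  continuous_path ω := by have := hW.continuous_path ω; fun_prop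
  measurable_eval t := (hW.measurable_eval _).sub (hW.measurable_eval _)

/-- A Brownian motion is indistinguishable from a regular one. -/
lemma exists_isRegularBM [IsProbabilityMeasure P] (hW : IsBrownianReal W P) :
    ∃ W' : ℝ≥0 → Ω → ℝ, IsRegularBM W' P ∧ ∀ᵐ ω ∂P, ∀ t, W t ω = W' t ω := by
  obtain ⟨S, hSc, hSd⟩ := TopologicalSpace.exists_countable_dense ℝ≥0
  have hae : ∀ᵐ ω ∂P, Continuous (W · ω) ∧ ∀ s ∈ S, W s ω = (hW.aemeasurable s).mk (W s) ω :=
    hW.cont.and ((ae_ball_iff hSc).2 fun s _ => (hW.aemeasurable s).ae_eq_mk)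
  -- Setting the process to zero on a measurable null set keeps paths continuous and makes it
  -- measurable at countably many dense times; all other times are pointwise limits of these.
  set N : Set Ω := toMeasurable P {ω | ¬ (Continuous (W · ω) ∧
    ∀ s ∈ S, W s ω = (hW.aemeasurable s).mk (W s) ω)} with hN
  have hNm : MeasurableSet N := measurableSet_toMeasurable _ _
  have hN0 : P N = 0 := by rw [hN, measure_toMeasurable]; exact hae
  have hgood : ∀ ω ∉ N, Continuous (W · ω) ∧
      ∀ s ∈ S, W s ω = (hW.aemeasurable s).mk (W s) ω := fun ω hω => by
    by_contra hcon
    exact hω (subset_toMeasurable _ _ hcon)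
  let W' : ℝ≥0 → Ω → ℝ := fun t => Nᶜ.indicator (W t)
  have hc : ∀ ω, Continuous (W' · ω) := fun ω => by
    by_cases hω : ω ∈ N
    · have : (fun t => W' t ω) = fun _ => 0 := by
        funext t; exact indicator_of_notMem (by simpa using hω) _
      rw [this]; exact continuous_const
    · have : (fun t => W' t ω) = fun t => W t ω := by
        funext t; exact indicator_of_mem hω _
      rw [this]; exact (hgood ω hω).1
  have hms : ∀ s ∈ S, Measurable (W' s) := fun s hs => by
    have : W' s = Nᶜ.indicator ((hW.aemeasurable s).mk (W s)) := by
      funext ω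
      by_cases hω : ω ∈ Nᶜ
      · simp only [W', indicator_of_mem hω]; exact (hgood ω hω).2 s hs
      · simp only [W', indicator_of_notMem hω]
    rw [this]
    exact (hW.aemeasurable s).measurable_mk.indicator hNm.compl
  have hmt : ∀ t, Measurable (W' t) := fun t => by
    obtain ⟨u, hu, hut⟩ := mem_closure_iff_seq_limit.1 (hSd t)
    exact measurable_of_tendsto_metrizable (fun n => hms (u n) (hu n))
      (tendsto_pi_nhds.2 fun ω => ((hc ω).tendsto t).comp hut)
  have heq : ∀ᵐ ω ∂P, ∀ t, W t ω = W' t ω := by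
    have : ∀ᵐ ω ∂P, ω ∈ Nᶜ := measure_eq_zero_iff_ae_notMem.1 hN0
    filter_upwards [this] with ω hω t
    simp only [W', indicator_of_mem hω]
  exact ⟨W', { toIsPreBrownianReal := hW.toIsPreBrownianReal.congr
                fun t => heq.mono fun ω h => h t
               continuous_path := hc
               measurable_eval := hmt }, heq⟩

/-- The moments of the additive functional. -/
noncomputable def moment {Ω : Type*} [MeasurableSpace Ω] (P : Measure Ω) (V : ℝ → ℝ)
    (W : ℝ≥0 → Ω → ℝ) (n : ℕ) (t y : ℝ) : ℝ :=
  ∫ ω, additive V W t y ω ^ n ∂P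

section paths

variable {V : ℝ → ℝ} {C : ℝ}

lemma IsRegularBM.measurable_additive (hW : IsRegularBM W P) (hV : Measurable V) (t y : ℝ) :
    Measurable (additive V W t y) :=
  (TargetZone.measurable_additive hW.continuous_path hW.measurable_eval hV).comp
    (measurable_prodMk_left (x := (t, y)))

lemma IsRegularBM.integrable_additive_pow [IsProbabilityMeasure P] (hW : IsRegularBM W P)
    (hV : Measurable V) (hC : ∀ x, |V x| ≤ C) (n : ℕ) (t y : ℝ) :
    Integrable (fun ω => additive V W t y ω ^ n) P := by
  refine Integrable.of_bound ((hW.measurable_additive hV t y).pow_const n).aestronglyMeasurable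
    ((C * |t|) ^ n) (Eventually.of_forall fun ω => ?_)
  rw [norm_pow]
  exact pow_le_pow_left₀ (norm_nonneg _) (abs_additive_le hC y ω) n

lemma IsRegularBM.measurable_moment [IsProbabilityMeasure P] (hW : IsRegularBM W P)
    (hV : Measurable V) (n : ℕ) :
    Measurable (fun p : ℝ × ℝ => moment P V W n p.1 p.2) :=
  (((TargetZone.measurable_additive hW.continuous_path hW.measurable_eval hV).pow_const
    n).stronglyMeasurable.integral_prod_right).measurable

/-- Markov property for the moments of an additive functional. -/
lemma IsRegularBM.moment_succ_shift [IsProbabilityMeasure P] (hW : IsRegularBM W P)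
    (hV : Measurable V) (hC : ∀ x, |V x| ≤ C) (n : ℕ) {t : ℝ} (ht : 0 ≤ t) (y : ℝ) :
    moment P V W (n + 1) t y = (n + 1) * ∫ s in (0 : ℝ)..t, ∫ z, V (y + z) *
      moment P V (fun r ω => W (s.toNNReal + r) ω - W s.toNNReal ω) n (t - s) (y + z)
        ∂(gaussianReal 0 s.toNNReal) := by
  have hC0 : 0 ≤ C := (abs_nonneg _).trans (hC 0)
  have hpath : ∀ ω, Measurable fun r : ℝ => V (y + W r.toNNReal ω) := fun ω => by
    have := hW.continuous_path ω
    exact hV.comp (by fun_prop)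
  have hint : ∀ ω a b, IntervalIntegrable (fun r => V (y + W r.toNNReal ω)) volume a b :=
    fun ω a b => by
      refine ⟨?_, ?_⟩ <;>
      exact Integrable.of_bound (hpath ω).aestronglyMeasurable C (Eventually.of_forall fun r => hC _)
  have h1 : ∀ ω, additive V W t y ω ^ (n + 1) = (n + 1) * ∫ s in (0 : ℝ)..t,
      V (y + W s.toNNReal ω) * (∫ r in s..t, V (y + W r.toNNReal ω)) ^ n := fun ω =>
    pow_succ_intervalIntegral (hint ω 0 t) n
  simp_rw [moment, h1, integral_const_mul]
  congr 1
  simp_rw [intervalIntegral.integral_of_le ht]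
  rw [integral_integral_swap]
  · refine setIntegral_congr_fun measurableSet_Ioc fun s hs => ?_
    have hs0 : (0 : ℝ) ≤ s := hs.1.le
    set W' : ℝ≥0 → Ω → ℝ := fun r ω => W (s.toNNReal + r) ω - W s.toNNReal ω with hW'
    have hR := hW.shift s.toNNReal
    -- After time `s` the integral is an additive functional of the increments `W'`, started at `y +
    -- W s`; by independence that starting point can be frozen.
    have hshift : ∀ ω, ∫ r in s..t, V (y + W r.toNNReal ω) =
        additive V W' (t - s) (y + W s.toNNReal ω) ω := fun ω => by
      have := intervalIntegral.integral_comp_add_right (a := 0) (b := t - s)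
        (fun r => V (y + W r.toNNReal ω)) s
      rw [zero_add, sub_add_cancel] at this
      rw [← this, additive]
      refine intervalIntegral.integral_congr fun r hr => ?_
      rw [uIcc_of_le (by linarith [hs.2])] at hr
      simp only [hW']
      rw [Real.toNNReal_add hr.1 hs0, add_comm r.toNNReal]
      congr 1
      ring
    simp only [hshift]
    have hind : IndepFun (W s.toNNReal) (fun ω r => W' r ω) P := by
      have h := hW.toIsPreBrownianReal.indepFun_shift s.toNNReal
      exact (h.comp measurable_id
        (measurable_pi_apply (⟨s.toNNReal, mem_Iic.2 le_rfl⟩ : Set.Iic s.toNNReal))).symm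
    have hmeasW' : Measurable (fun ω r => W' r ω) :=
      measurable_pi_lambda _ fun r => hR.measurable_eval r
    have hcomap : ∀ r, Measurable[MeasurableSpace.comap (fun ω r => W' r ω) inferInstance] (W' r) :=
      fun r => (measurable_pi_apply r).comp (comap_measurable (fun ω r => W' r ω))
    have hF : Measurable[Prod.instMeasurableSpace
        (m₂ := MeasurableSpace.comap (fun ω r => W' r ω) inferInstance)]
        (Function.uncurry fun (z : ℝ) (ω : Ω) => V (y + z) * additive V W' (t - s) (y + z) ω ^ n) := by
      have h := TargetZone.measurable_additive
        (m := MeasurableSpace.comap (fun ω r => W' r ω) inferInstance)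
        hR.continuous_path hcomap hV
      let _ : MeasurableSpace Ω := MeasurableSpace.comap (fun ω r => W' r ω) inferInstance
      refine (hV.comp (measurable_fst.const_add y)).mul (Measurable.pow_const ?_ n)
      exact h.comp ((measurable_const.prodMk (measurable_fst.const_add y)).prodMk measurable_snd)
    have hbound : ∀ (z : ℝ) (ω : Ω), |V (y + z) * additive V W' (t - s) (y + z) ω ^ n| ≤
        C * (C * |t - s|) ^ n := fun z ω => by
      rw [abs_mul, abs_pow]
      exact mul_le_mul (hC _) (pow_le_pow_left₀ (abs_nonneg _) (abs_additive_le hC _ ω) n)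
        (by positivity) hC0
    have := integral_of_indepFun_comap (hW.measurable_eval s.toNNReal) hmeasW' hind hF hbound
    rw [(hW.toIsPreBrownianReal.hasLaw_eval s.toNNReal).map_eq] at this
    rw [this]
    simp_rw [integral_const_mul]
  · refine Integrable.of_bound (C := C * (C * |t|) ^ n) ?_ ?_
    · refine Measurable.aestronglyMeasurable ?_
      have h2 := measurable_uncurry_path hW.continuous_path hW.measurable_eval
      have h3 := measurable_additive_aux hW.continuous_path hW.measurable_eval hV
      refine Measurable.mul (hV.comp (Measurable.const_add (h2.comp measurable_swap) y))
        (Measurable.pow_const ?_ n)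
      exact h3.comp ((measurable_snd.prodMk measurable_const).prodMk
        (measurable_const.prodMk measurable_fst))
    · have : ∀ᵐ p ∂(P.prod (volume.restrict (Ioc 0 t))), p.2 ∈ Ioc 0 t :=
        Measure.quasiMeasurePreserving_snd.ae (ae_restrict_mem measurableSet_Ioc)
      filter_upwards [this] with p hp
      simp only [Function.uncurry]
      rw [norm_mul, norm_pow]
      refine mul_le_mul (hC _) (pow_le_pow_left₀ (norm_nonneg _) ?_ n) (by positivity) hC0
      refine (intervalIntegral.norm_integral_le_of_norm_le_const fun x _ => hC _).trans ?_
      rw [abs_of_nonneg (sub_nonneg.2 hp.2), abs_of_nonneg ht]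
      gcongr
      linarith [hp.1]

/-- The moments of an additive functional depend only on the law of the Brownian motion. -/
lemma IsRegularBM.moment_eq [IsProbabilityMeasure P] (hV : Measurable V) (hC : ∀ x, |V x| ≤ C)
    (n : ℕ) : ∀ {W W' : ℝ≥0 → Ω → ℝ}, IsRegularBM W P → IsRegularBM W' P → ∀ {t : ℝ}, 0 ≤ t →
      ∀ y, moment P V W n t y = moment P V W' n t y := by
  -- `W` and `W'` remain universally quantified because the recursion passes to their shifts at time
  -- `s`.
  induction n with
  | zero => intros; simp [moment]
  | succ n ih =>
    intro W W' hW hW' t ht y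
    rw [hW.moment_succ_shift hV hC n ht, hW'.moment_succ_shift hV hC n ht]
    congr 1
    refine intervalIntegral.integral_congr fun s hs => ?_
    rw [uIcc_of_le ht] at hs
    simp only [ih (hW.shift s.toNNReal) (hW'.shift s.toNNReal) (sub_nonneg.2 hs.2)]

/-- Recursion for the moments of an additive functional of Brownian motion. -/
lemma IsRegularBM.moment_succ [IsProbabilityMeasure P] (hW : IsRegularBM W P)
    (hV : Measurable V) (hC : ∀ x, |V x| ≤ C) (n : ℕ) {t : ℝ} (ht : 0 ≤ t) (y : ℝ) :
    moment P V W (n + 1) t y = (n + 1) * ∫ s in (0 : ℝ)..t, ∫ z, V (y + z) *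
      moment P V W n (t - s) (y + z) ∂(gaussianReal 0 s.toNNReal) := by
  rw [hW.moment_succ_shift hV hC n ht]
  congr 1
  refine intervalIntegral.integral_congr fun s hs => ?_
  rw [uIcc_of_le ht] at hs
  simp only [IsRegularBM.moment_eq hV hC n (hW.shift s.toNNReal) hW (sub_nonneg.2 hs.2)]

end paths

end markov

/-! ### The error function. -/

section error_function

lemma hasDerivAt_erf (x : ℝ) : HasDerivAt erf (2 / √Real.pi * Real.exp (-x ^ 2)) x := by
  have hc : Continuous fun y : ℝ => Real.exp (-y ^ 2) := by fun_prop
  exact (intervalIntegral.integral_hasDerivAt_right (hc.intervalIntegrable _ _)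
    (hc.stronglyMeasurableAtFilter _ _) hc.continuousAt).const_mul _

lemma continuous_erf : Continuous erf :=
  continuous_iff_continuousAt.2 fun x => (hasDerivAt_erf x).continuousAt

@[simp] lemma erf_zero : erf 0 = 0 := by simp [erf]

lemma erf_neg (x : ℝ) : erf (-x) = - erf x := by
  have h := intervalIntegral.integral_comp_neg (a := 0) (b := x) fun y : ℝ => Real.exp (-y ^ 2)
  simp only [neg_sq, neg_zero] at h
  rw [erf, erf, h, intervalIntegral.integral_symm (-x) 0]
  ring

lemma tendsto_erf_atTop : Tendsto erf atTop (𝓝 1) := by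
  have h := integral_gaussian_Ioi 1
  have hi : IntegrableOn (fun x : ℝ => Real.exp (-x ^ 2)) (Ioi 0) := by
    simpa using (integrable_exp_neg_mul_sq one_pos).integrableOn (s := Ioi 0)
  have h2 := (intervalIntegral_tendsto_integral_Ioi 0 hi tendsto_id).const_mul (2 / √Real.pi)
  simp only [neg_mul, one_mul, div_one] at h
  rw [h] at h2
  have hpi : √Real.pi ≠ 0 := by positivity
  have : 2 / √Real.pi * (√Real.pi / 2) = 1 := by field_simp
  rw [this] at h2
  exact h2

lemma tendsto_erf_atBot : Tendsto erf atBot (𝓝 (-1)) := by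
  have h := (tendsto_erf_atTop.comp tendsto_neg_atBot_atTop).neg
  refine h.congr fun x => ?_
  simp [erf_neg]

lemma strictMono_erf : StrictMono erf :=
  strictMono_of_deriv_pos fun x => by
    rw [(hasDerivAt_erf x).deriv]
    positivity

lemma erf_nonneg {x : ℝ} (hx : 0 ≤ x) : 0 ≤ erf x := by
  simpa using strictMono_erf.monotone hx

lemma erf_lt_one (x : ℝ) : erf x < 1 :=
  (strictMono_erf (lt_add_one x)).trans_le
    (strictMono_erf.monotone.ge_of_tendsto tendsto_erf_atTop _)

end error_function

/-! ### The heat kernel and its tails. -/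

/-- The heat kernel. -/
noncomputable def heat (s z : ℝ) : ℝ := (√(2 * Real.pi * s))⁻¹ * Real.exp (-z ^ 2 / (2 * s))

lemma heat_nonneg (s z : ℝ) : 0 ≤ heat s z := by unfold heat; positivity

lemma heat_neg (s z : ℝ) : heat s (-z) = heat s z := by simp [heat]

lemma measurable_heat : Measurable (Function.uncurry heat) := by
  unfold heat Function.uncurry
  fun_prop

lemma continuous_heat (s : ℝ) : Continuous (heat s) := by unfold heat; fun_prop

lemma heat_le {s : ℝ} (hs : 0 ≤ s) (z : ℝ) : heat s z ≤ heat s 0 := by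
  unfold heat
  refine mul_le_mul_of_nonneg_left (Real.exp_le_exp.2 ?_) (by positivity)
  rw [zero_pow two_ne_zero, neg_zero, zero_div]
  exact div_nonpos_of_nonpos_of_nonneg (by nlinarith [sq_nonneg z]) (by positivity)

lemma hasDerivAt_half_erf {t : ℝ} (ht : 0 < t) (y : ℝ) :
    HasDerivAt (fun y => 1 / 2 * erf (y / √(2 * t))) (heat t y) y := by
  have h := ((hasDerivAt_erf (y / √(2 * t))).comp y
    ((hasDerivAt_id y).div_const (√(2 * t)))).const_mul (1 / 2)
  refine h.congr_deriv ?_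
  have h1 : √(2 * Real.pi * t) = √Real.pi * √(2 * t) := by
    rw [← Real.sqrt_mul Real.pi_pos.le]; ring_nf
  have h2 : √(2 * t) ^ 2 = 2 * t := Real.sq_sqrt (by positivity)
  have h3 : √(2 * t) ≠ 0 := by positivity
  have h4 : √Real.pi ≠ 0 := by positivity
  simp only [heat]
  rw [div_pow, h2, h1, neg_div]
  field_simp

lemma tendsto_half_erf {t : ℝ} (ht : 0 < t) :
    Tendsto (fun y => 1 / 2 * erf (y / √(2 * t))) atTop (𝓝 (1 / 2)) := by
  have h := (tendsto_erf_atTop.comp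
    (tendsto_id.atTop_div_const (by positivity : 0 < √(2 * t)))).const_mul (1 / 2)
  simpa using h

lemma hasDerivAt_half_erf_add {t : ℝ} (ht : 0 < t) (a y : ℝ) :
    HasDerivAt (fun y => 1 / 2 * erf ((a + y) / √(2 * t))) (heat t (a + y)) y :=
  (hasDerivAt_half_erf ht (a + y)).comp_const_add a y

lemma tendsto_half_erf_add {t : ℝ} (ht : 0 < t) (a : ℝ) :
    Tendsto (fun y => 1 / 2 * erf ((a + y) / √(2 * t))) atTop (𝓝 (1 / 2)) :=
  (tendsto_half_erf ht).comp (tendsto_atTop_add_const_left _ a tendsto_id)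

lemma integrableOn_heat_add {t : ℝ} (ht : 0 < t) (a : ℝ) :
    IntegrableOn (fun y => heat t (a + y)) (Ioi 0) :=
  integrableOn_Ioi_deriv_of_nonneg' (fun x _ => hasDerivAt_half_erf_add ht a x)
    (fun x _ => heat_nonneg t _) (tendsto_half_erf_add ht a)

/-- The Gaussian tail in terms of the error function. -/
lemma two_mul_integral_heat_add {t : ℝ} (ht : 0 < t) (a : ℝ) :
    2 * ∫ y in Ioi 0, heat t (a + y) = 1 - erf (a / √(2 * t)) := by
  rw [integral_Ioi_of_hasDerivAt_of_nonneg' (fun x _ => hasDerivAt_half_erf_add ht a x)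
    (fun x _ => heat_nonneg t _) (tendsto_half_erf_add ht a), add_zero]
  ring

/-! ### First passage identities: `a / s * heat s a` is the density of the hitting time of a level
at distance `a`. -/

section first_passage

variable {t a r s : ℝ}

lemma hasDerivAt_passage_arg (hs : 0 < s) (hst : s < t) (a ρ : ℝ) :
    HasDerivAt (fun s => (a * (t - s) - ρ * s) / √(2 * t * s * (t - s)))
      (-(t ^ 2 * (a * (t - s) + ρ * s)) / √(2 * t * s * (t - s)) ^ 3) s := by
  have ht : 0 < t := hs.trans hst
  have hts : 0 < t - s := sub_pos.2 hst
  have hq : 0 < 2 * t * s * (t - s) := by positivity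
  have h1 : HasDerivAt (fun s => a * (t - s) - ρ * s) (-(a + ρ)) s := by
    have := (((hasDerivAt_id s).const_sub t).const_mul a).sub ((hasDerivAt_id s).const_mul ρ)
    exact this.congr_deriv (by ring)
  have h2 : HasDerivAt (fun s => 2 * t * s * (t - s)) (2 * t * (t - 2 * s)) s := by
    have := ((hasDerivAt_id s).const_mul (2 * t)).mul ((hasDerivAt_id s).const_sub t)
    exact this.congr_deriv (by simp only [id]; ring)
  have h3 := h1.div (h2.sqrt hq.ne') (by positivity)
  refine h3.congr_deriv ?_
  have hsq : √(2 * t * s * (t - s)) ^ 2 = 2 * t * s * (t - s) := Real.sq_sqrt hq.le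
  have hne : √(2 * t * s * (t - s)) ≠ 0 := by positivity
  field_simp
  rw [hsq]
  ring

/-- This is the Brownian bridge identity `(a + ρ)² / 2t + (a(t - s) - ρs)² / (2ts(t - s)) = a² / 2s
+ ρ² / (2(t - s))`. The right side is even in `ρ`. -/
lemma heat_mul_exp_passage (hs : 0 < s) (hst : s < t) (a ρ : ℝ) :
    heat t (a + ρ) * Real.exp (-((a * (t - s) - ρ * s) / √(2 * t * s * (t - s))) ^ 2) =
      (√(2 * Real.pi * t))⁻¹ * Real.exp (-(a ^ 2 / (2 * s) + ρ ^ 2 / (2 * (t - s)))) := by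
  have ht : 0 < t := hs.trans hst
  have hts : 0 < t - s := sub_pos.2 hst
  rw [heat, mul_assoc, ← Real.exp_add, div_pow, Real.sq_sqrt (by positivity)]
  congr 2
  field_simp
  ring

/-- A primitive in `s` of `(a / s) p_s(a) p_{t-s}(r)`. -/
lemma hasDerivAt_passage (hs : 0 < s) (hst : s < t) (a r : ℝ) :
    HasDerivAt (fun s => -(1 / 2) *
      (heat t (a + r) * erf ((a * (t - s) - r * s) / √(2 * t * s * (t - s))) +
        heat t (a + -r) * erf ((a * (t - s) - -r * s) / √(2 * t * s * (t - s)))))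
      (a / s * heat s a * heat (t - s) r) s := by
  have ht : 0 < t := hs.trans hst
  have hts : 0 < t - s := sub_pos.2 hst
  have h1 := (hasDerivAt_erf _).comp s (hasDerivAt_passage_arg hs hst a r)
  have h2 := (hasDerivAt_erf _).comp s (hasDerivAt_passage_arg hs hst a (-r))
  have h3 := ((h1.const_mul (heat t (a + r))).add (h2.const_mul (heat t (a + -r)))).const_mul
    (-(1 / 2) : ℝ)
  refine h3.congr_deriv ?_
  symm
  -- Both error functions contribute the same Gaussian factor, so only the sum of the derivatives of
  -- their arguments matters; adding `ρ = r` and `ρ = -r` removes the terms in `r` and leaves a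
  -- multiple of `a`.
  have e1 := heat_mul_exp_passage hs hst a r
  have e2 := heat_mul_exp_passage hs hst a (-r)
  rw [neg_sq] at e2
  have rhs : ∀ A E₁ B E₂ D₁ D₂ k : ℝ, -(1 / 2) * (A * (k * E₁ * D₁) + B * (k * E₂ * D₂)) =
    -(1 / 2) * k * ((A * E₁) * D₁ + (B * E₂) * D₂) := by intros; ring
  rw [rhs, e1, e2]
  have hexp : heat s a * heat (t - s) r = (√(2 * Real.pi * s))⁻¹ * (√(2 * Real.pi * (t - s)))⁻¹ *
      Real.exp (-(a ^ 2 / (2 * s) + r ^ 2 / (2 * (t - s)))) := by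
    rw [heat, heat, neg_add, Real.exp_add, neg_div, neg_div]
    ring
  rw [mul_assoc, hexp]
  generalize Real.exp (-(a ^ 2 / (2 * s) + r ^ 2 / (2 * (t - s)))) = E
  have q1 : √(2 * Real.pi * s) = √2 * √Real.pi * √s := by
    rw [Real.sqrt_mul (by positivity), Real.sqrt_mul (by positivity)]
  have q2 : √(2 * Real.pi * (t - s)) = √2 * √Real.pi * √(t - s) := by
    rw [Real.sqrt_mul (by positivity), Real.sqrt_mul (by positivity)]
  have q3 : √(2 * Real.pi * t) = √2 * √Real.pi * √t := by
    rw [Real.sqrt_mul (by positivity), Real.sqrt_mul (by positivity)]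
  have q4 : √(2 * t * s * (t - s)) = √2 * √t * √s * √(t - s) := by
    rw [Real.sqrt_mul (by positivity), Real.sqrt_mul (by positivity),
      Real.sqrt_mul (by positivity)]
  rw [q1, q2, q3, q4]
  have s2 : √2 ^ 2 = 2 := Real.sq_sqrt (by positivity)
  have st : √t ^ 2 = t := Real.sq_sqrt ht.le
  have ss : √s ^ 2 = s := Real.sq_sqrt hs.le
  have sts : √(t - s) ^ 2 = t - s := Real.sq_sqrt hts.le
  have n2 : √2 ≠ 0 := by positivity
  have nt : √t ≠ 0 := by positivity
  have ns : √s ≠ 0 := by positivity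
  have nts : √(t - s) ≠ 0 := by positivity
  have np : √Real.pi ≠ 0 := by positivity
  field_simp
  rw [show √t ^ 4 = (√t ^ 2) ^ 2 by ring, s2, st, ss, sts]
  ring

/-- Improper fundamental theorem of calculus on a bounded interval, nonnegative derivative. -/
lemma lintegral_Ioo_of_hasDerivAt {f f' : ℝ → ℝ} {a b fa fb : ℝ} (hab : a < b)
    (hderiv : ∀ x ∈ Ioo a b, HasDerivAt f (f' x) x) (hpos : ∀ x ∈ Ioo a b, 0 ≤ f' x)
    (ha : Tendsto f (𝓝[>] a) (𝓝 fa)) (hb : Tendsto f (𝓝[<] b) (𝓝 fb)) :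
    ∫⁻ x in Ioo a b, ENNReal.ofReal (f' x) = ENNReal.ofReal (fb - fa) := by
  have hcont : ContinuousOn (extendFrom (Ioo a b) f) (Icc a b) :=
    continuousOn_Icc_extendFrom_Ioo
      (fun x hx => (hderiv x hx).continuousAt.continuousWithinAt) ha hb
  have heq : ∀ x ∈ Ioo a b, extendFrom (Ioo a b) f x = f x := fun x hx =>
    extendFrom_eq (subset_closure hx) ((hderiv x hx).continuousAt.tendsto.mono_left
      nhdsWithin_le_nhds)
  -- Integrability is not assumed: it follows from the sign of `f'` and the finite boundary limits.
  have hint : IntegrableOn f' (Ioc a b) :=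
    intervalIntegral.integrableOn_deriv_of_nonneg hcont (fun x hx =>
      (hderiv x hx).congr_of_eventuallyEq
        (eventually_of_mem (isOpen_Ioo.mem_nhds hx) heq)) hpos
  have h := intervalIntegral.integral_eq_sub_of_hasDerivAt_of_tendsto hab hderiv
    ((intervalIntegrable_iff_integrableOn_Ioc_of_le hab.le).2 hint) ha hb
  rw [intervalIntegral.integral_of_le hab.le, integral_Ioc_eq_integral_Ioo] at h
  rw [← h, ofReal_integral_eq_lintegral_ofReal (hint.mono_set Ioo_subset_Ioc_self)]
  exact (ae_restrict_iff' measurableSet_Ioo).2 (Eventually.of_forall hpos)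

lemma tendsto_inv_passage_left (ht : 0 < t) :
    Tendsto (fun s => (√(2 * t * s * (t - s)))⁻¹) (𝓝[>] 0) atTop := by
  refine tendsto_inv_nhdsGT_zero.comp (tendsto_nhdsWithin_iff.2 ⟨?_, ?_⟩)
  · have : Continuous fun s => √(2 * t * s * (t - s)) := by fun_prop
    simpa using (this.tendsto 0).mono_left nhdsWithin_le_nhds
  · filter_upwards [Ioo_mem_nhdsGT ht] with s hs
    have := hs.1
    have := sub_pos.2 hs.2
    exact mem_Ioi.2 (by positivity)

lemma tendsto_inv_passage_right (ht : 0 < t) :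
    Tendsto (fun s => (√(2 * t * s * (t - s)))⁻¹) (𝓝[<] t) atTop := by
  refine tendsto_inv_nhdsGT_zero.comp (tendsto_nhdsWithin_iff.2 ⟨?_, ?_⟩)
  · have : Continuous fun s => √(2 * t * s * (t - s)) := by fun_prop
    simpa using (this.tendsto t).mono_left nhdsWithin_le_nhds
  · filter_upwards [Ioo_mem_nhdsLT ht] with s hs
    have := hs.1
    have := sub_pos.2 hs.2
    exact mem_Ioi.2 (by positivity)

/-- First passage decomposition of the heat kernel. -/
lemma lintegral_passage (ht : 0 < t) (ha : 0 < a) (hr : 0 < r) :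
    ∫⁻ s in Ioo 0 t, ENNReal.ofReal (a / s * heat s a * heat (t - s) r) =
      ENNReal.ofReal (heat t (a + r)) := by
  have hnum : ∀ ρ : ℝ, Continuous fun s => a * (t - s) - ρ * s := fun ρ => by fun_prop
  have hL : ∀ ρ : ℝ, Tendsto (fun s => erf ((a * (t - s) - ρ * s) / √(2 * t * s * (t - s))))
      (𝓝[>] 0) (𝓝 1) := fun ρ => by
    have h1 := ((hnum ρ).tendsto 0).mono_left (nhdsWithin_le_nhds (s := Ioi 0))
    exact tendsto_erf_atTop.comp
      (h1.pos_mul_atTop (by simpa using mul_pos ha ht) (tendsto_inv_passage_left ht))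
  have hR1 : Tendsto (fun s => erf ((a * (t - s) - r * s) / √(2 * t * s * (t - s))))
      (𝓝[<] t) (𝓝 (-1)) := by
    have h1 := ((hnum r).tendsto t).mono_left (nhdsWithin_le_nhds (s := Iio t))
    exact tendsto_erf_atBot.comp
      (h1.neg_mul_atTop (by simpa using mul_pos hr ht) (tendsto_inv_passage_right ht))
  have hR2 : Tendsto (fun s => erf ((a * (t - s) - -r * s) / √(2 * t * s * (t - s))))
      (𝓝[<] t) (𝓝 1) := by
    have h1 := ((hnum (-r)).tendsto t).mono_left (nhdsWithin_le_nhds (s := Iio t))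
    exact tendsto_erf_atTop.comp
      (h1.pos_mul_atTop (by simpa using mul_pos hr ht) (tendsto_inv_passage_right ht))
  -- Both error functions tend to `1` at `0`, and to `-1` and `1` at `t`, so the terms `heat t (a +
  -- -r)` cancel and `heat t (a + r)` remains.
  rw [lintegral_Ioo_of_hasDerivAt ht (fun s hs => hasDerivAt_passage hs.1 hs.2 a r)
    (fun s hs => mul_nonneg (mul_nonneg (div_nonneg ha.le hs.1.le) (heat_nonneg _ _))
      (heat_nonneg _ _))
    ((((hL r).const_mul _).add ((hL (-r)).const_mul _)).const_mul _)
    (((hR1.const_mul _).add (hR2.const_mul _)).const_mul _)]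
  congr 1
  ring

/-- The heat kernel as the integral of its derivative. -/
lemma lintegral_div_mul_heat (hs : 0 < s) (ha : 0 ≤ a) :
    ∫⁻ x in Ioi a, ENNReal.ofReal (x / s * heat s x) = ENNReal.ofReal (heat s a) := by
  have hd : ∀ x ∈ Ici a, HasDerivAt (fun x => -heat s x) (x / s * heat s x) x := fun x _ => by
    have h1 : HasDerivAt (fun x : ℝ => -x ^ 2 / (2 * s)) (-(2 * x) / (2 * s)) x := by
      simpa using ((hasDerivAt_pow 2 x).neg).div_const (2 * s)
    have h2 := (h1.exp.const_mul (√(2 * Real.pi * s))⁻¹).neg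
    refine h2.congr_deriv ?_
    rw [heat]
    field_simp
  have hp : ∀ x ∈ Ioi a, 0 ≤ x / s * heat s x := fun x hx =>
    mul_nonneg (div_nonneg (ha.trans (mem_Ioi.1 hx).le) hs.le) (heat_nonneg _ _)
  have hl : Tendsto (fun x => -heat s x) atTop (𝓝 0) := by
    have h1 : Tendsto (fun x : ℝ => -x ^ 2 / (2 * s)) atTop atBot := by
      have := (tendsto_neg_atTop_atBot.comp (tendsto_pow_atTop (α := ℝ) two_ne_zero)).atBot_div_const
        (by positivity : 0 < 2 * s)
      exact this
    simpa [heat] using ((Real.tendsto_exp_atBot.comp h1).const_mul (√(2 * Real.pi * s))⁻¹).neg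
  have h := integral_Ioi_of_hasDerivAt_of_nonneg' hd hp hl
  rw [← ofReal_integral_eq_lintegral_ofReal (integrableOn_Ioi_deriv_of_nonneg' hd hp hl), h]
  · simp
  · exact (ae_restrict_iff' measurableSet_Ioi).2 (Eventually.of_forall hp)

/-- The convolution of two heat kernels in time is a Gaussian tail. -/
lemma lintegral_heat_mul_heat (ht : 0 < t) (ha : 0 ≤ a) (hr : 0 < r) :
    ∫⁻ s in Ioo 0 t, ENNReal.ofReal (heat s a) * ENNReal.ofReal (heat (t - s) r) =
      ∫⁻ y in Ioi 0, ENNReal.ofReal (heat t (a + (r + y))) := by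
  -- Writing `heat s a` as an integral of hitting densities over the levels `x > a` reduces the
  -- claim to `lintegral_passage`; only positive levels occur, so `a = 0` is included.
  have h1 : ∀ s ∈ Ioo 0 t, ENNReal.ofReal (heat s a) * ENNReal.ofReal (heat (t - s) r) =
      ∫⁻ x in Ioi a, ENNReal.ofReal (x / s * heat s x * heat (t - s) r) := fun s hs => by
    rw [← lintegral_div_mul_heat hs.1 ha, ← lintegral_mul_const']
    · refine setLIntegral_congr_fun measurableSet_Ioi fun x hx => ?_
      rw [← ENNReal.ofReal_mul]
      exact mul_nonneg (div_nonneg (ha.trans (mem_Ioi.1 hx).le) hs.1.le) (heat_nonneg _ _)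
    · exact ENNReal.ofReal_ne_top
  rw [setLIntegral_congr_fun measurableSet_Ioo h1, lintegral_lintegral_swap]
  · rw [setLIntegral_congr_fun measurableSet_Ioi fun x hx =>
      lintegral_passage ht (ha.trans_lt (mem_Ioi.1 hx)) hr]
    have := lintegral_add_left_eq_self (μ := volume)
      (fun x => (Ioi a).indicator (fun x => ENNReal.ofReal (heat t (x + r))) x) a
    rw [lintegral_indicator measurableSet_Ioi] at this
    rw [← this, ← lintegral_indicator measurableSet_Ioi]
    refine lintegral_congr fun y => ?_
    by_cases hy : 0 < y
    · rw [indicator_of_mem (by simpa using hy), indicator_of_mem (by simpa using hy)]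
      congr 2; ring
    · rw [indicator_of_notMem (by simpa using hy), indicator_of_notMem (by simpa using hy)]
  · refine (ENNReal.measurable_ofReal.comp ?_).aemeasurable
    refine Measurable.mul (Measurable.mul (measurable_snd.div measurable_fst)
      (measurable_heat.comp (measurable_fst.prodMk measurable_snd))) ?_
    exact measurable_heat.comp ((measurable_const.sub measurable_fst).prodMk measurable_const)

end first_passage

/-! ### Gaussian tail moments and Kac's recursion at a point. -/

/-- The tail moments of the Gaussian law, with values in `[0, ∞]`. -/
noncomputable def tailMoment (n : ℕ) (t a : ℝ) : ENNReal :=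
  ∫⁻ r in Ioi 0, ENNReal.ofReal (2 * r ^ n) * ENNReal.ofReal (heat t (a + r))

lemma measurable_tailMoment (n : ℕ) (a : ℝ) : Measurable fun t => tailMoment n t a := by
  unfold tailMoment
  refine Measurable.lintegral_prod_right' (ν := volume.restrict (Ioi 0))
    (f := fun p : ℝ × ℝ => ENNReal.ofReal (2 * p.2 ^ n) * ENNReal.ofReal (heat p.1 (a + p.2))) ?_
  refine Measurable.mul (by fun_prop) (ENNReal.measurable_ofReal.comp ?_)
  exact measurable_heat.comp (measurable_fst.prodMk (measurable_snd.const_add a))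

/-- By `lintegral_heat_mul_heat` the time integral of `p_s(a) p_{t-s}(r)` is the tail of `p_t(a +
u)` over `u > r`. Exchanging `r` and `u` leaves `(n + 1) ∫₀ᵘ 2 rⁿ dr = 2 uⁿ⁺¹`. With values in `[0,
∞]` Tonelli applies without integrability conditions. -/
lemma tailMoment_succ (n : ℕ) {t a : ℝ} (ht : 0 < t) (ha : 0 ≤ a) :
    tailMoment (n + 1) t a =
      (n + 1) * ∫⁻ s in Ioo 0 t, ENNReal.ofReal (heat s a) * tailMoment n (t - s) 0 := by
  have h1 : ∀ s, ENNReal.ofReal (heat s a) * tailMoment n (t - s) 0 = ∫⁻ r in Ioi 0,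
      ENNReal.ofReal (2 * r ^ n) * (ENNReal.ofReal (heat s a) * ENNReal.ofReal (heat (t - s) r)) :=
    fun s => by
      rw [tailMoment, ← lintegral_const_mul' _ _ ENNReal.ofReal_ne_top]
      refine lintegral_congr fun r => ?_
      rw [zero_add]; ring
  simp_rw [h1]
  rw [lintegral_lintegral_swap]
  swap
  · refine Measurable.aemeasurable (Measurable.mul (f := fun p : ℝ × ℝ =>
      ENNReal.ofReal (2 * p.2 ^ n)) (by fun_prop) (Measurable.mul
        (f := fun p : ℝ × ℝ => ENNReal.ofReal (heat p.1 a))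
        (g := fun p : ℝ × ℝ => ENNReal.ofReal (heat (t - p.1) p.2)) ?_ ?_))
    · exact ENNReal.measurable_ofReal.comp
        (measurable_heat.comp (measurable_fst.prodMk measurable_const))
    · exact ENNReal.measurable_ofReal.comp
        (measurable_heat.comp ((measurable_const.sub measurable_fst).prodMk measurable_snd))
  have h2 : ∀ r ∈ Ioi (0 : ℝ), (∫⁻ s in Ioo 0 t, ENNReal.ofReal (2 * r ^ n) *
      (ENNReal.ofReal (heat s a) * ENNReal.ofReal (heat (t - s) r))) =
      ∫⁻ u, (Ioi r).indicator
        (fun u => ENNReal.ofReal (2 * r ^ n) * ENNReal.ofReal (heat t (a + u))) u := fun r hr => by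
    rw [lintegral_const_mul' _ _ ENNReal.ofReal_ne_top, lintegral_heat_mul_heat ht ha hr,
      ← lintegral_const_mul' _ _ ENNReal.ofReal_ne_top, ← lintegral_indicator measurableSet_Ioi,
      ← lintegral_add_left_eq_self (μ := volume) ((Ioi r).indicator _) r]
    refine lintegral_congr fun y => ?_
    by_cases hy : 0 < y
    · rw [indicator_of_mem (by simpa using hy), indicator_of_mem (by simpa using hy)]
    · rw [indicator_of_notMem (by simpa using hy), indicator_of_notMem (by simpa using hy)]
  rw [setLIntegral_congr_fun measurableSet_Ioi h2, lintegral_lintegral_swap]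
  swap
  · have hs : MeasurableSet {p : ℝ × ℝ | p.1 < p.2} := measurableSet_lt measurable_fst measurable_snd
    have : Measurable fun p : ℝ × ℝ =>
        ENNReal.ofReal (2 * p.1 ^ n) * ENNReal.ofReal (heat t (a + p.2)) := by
      refine Measurable.mul (by fun_prop) (ENNReal.measurable_ofReal.comp ?_)
      exact (continuous_heat t).measurable.comp (measurable_snd.const_add a)
    exact (this.indicator hs).aemeasurable
  rw [tailMoment, ← lintegral_indicator measurableSet_Ioi, ← lintegral_const_mul' _ _ (by finiteness)]
  refine lintegral_congr fun u => ?_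
  rw [← lintegral_indicator measurableSet_Ioi]
  have h3 : ∀ r, (Ioi (0 : ℝ)).indicator (fun r => (Ioi r).indicator
      (fun u => ENNReal.ofReal (2 * r ^ n) * ENNReal.ofReal (heat t (a + u))) u) r =
      (Ioo 0 u).indicator (fun r => ENNReal.ofReal (2 * r ^ n)) r *
        ENNReal.ofReal (heat t (a + u)) := fun r => by
    by_cases h0 : 0 < r <;> by_cases hu : r < u <;> simp [indicator, h0, hu]
  simp_rw [h3]
  rw [lintegral_mul_const' _ _ ENNReal.ofReal_ne_top, lintegral_indicator measurableSet_Ioo,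
    ← mul_assoc]
  by_cases hu : 0 < u
  · rw [indicator_of_mem (mem_Ioi.2 hu)]
    congr 1
    have hint : IntegrableOn (fun r : ℝ => 2 * r ^ n) (Ioo 0 u) :=
      ((by fun_prop : Continuous fun r : ℝ => 2 * r ^ n).integrableOn_Icc).mono_set
        Ioo_subset_Icc_self
    rw [← ofReal_integral_eq_lintegral_ofReal hint
      ((ae_restrict_iff' measurableSet_Ioo).2 (Eventually.of_forall fun r hr => by
        have := hr.1.le
        positivity)), ← integral_Ioc_eq_integral_Ioo,
      ← intervalIntegral.integral_of_le hu.le, intervalIntegral.integral_const_mul, integral_pow,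
      show ((n : ENNReal) + 1) = ENNReal.ofReal ((n : ℝ) + 1) by
        rw [ENNReal.ofReal_add (by positivity) zero_le_one]; simp,
      ← ENNReal.ofReal_mul (by positivity)]
    congr 1
    rw [zero_pow (Nat.succ_ne_zero n)]
    field_simp
    ring
  · rw [indicator_of_notMem (by simpa using hu), Ioo_eq_empty hu]
    simp

/-! ### Moments and exponential moments of the limit law. -/

section limit_moments

variable {t a θ : ℝ}

/-- Completing the square: an exponential tilt by `θ` translates the Gaussian by `θ * t`. -/
lemma heat_add_mul_exp (ht : 0 < t) (a θ r : ℝ) :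
    heat t (a + r) * Real.exp (θ * r) =
      Real.exp (-θ * a + θ ^ 2 * t / 2) * heat t (a - θ * t + r) := by
  rw [heat, heat, mul_assoc, ← Real.exp_add, mul_left_comm, ← Real.exp_add]
  congr 2
  field_simp
  ring

lemma integrableOn_heat_add_mul_exp (ht : 0 < t) (a θ : ℝ) :
    IntegrableOn (fun r => heat t (a + r) * Real.exp (θ * r)) (Ioi 0) := by
  simp_rw [heat_add_mul_exp ht]
  exact (integrableOn_heat_add ht _).const_mul _

lemma two_mul_integral_heat_add_mul_exp (ht : 0 < t) (a θ : ℝ) :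
    2 * ∫ r in Ioi 0, heat t (a + r) * Real.exp (θ * r) =
      Real.exp (-θ * a + θ ^ 2 * t / 2) * (1 - erf ((a - θ * t) / √(2 * t))) := by
  simp_rw [heat_add_mul_exp ht]
  rw [integral_const_mul, mul_left_comm, two_mul_integral_heat_add ht]

/-- From `rⁿ ≤ n! eʳ`, the tilt with `θ = 1` dominates. -/
lemma integrableOn_pow_mul_heat_add (ht : 0 < t) (n : ℕ) (a : ℝ) :
    IntegrableOn (fun r => r ^ n * heat t (a + r)) (Ioi 0) := by
  refine ((integrableOn_heat_add_mul_exp ht a 1).const_mul (n.factorial : ℝ)).mono'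
    (Continuous.aestronglyMeasurable ?_) ?_
  · have := continuous_heat t
    fun_prop
  · refine (ae_restrict_iff' measurableSet_Ioi).2 (Eventually.of_forall fun r hr => ?_)
    have hr0 : 0 ≤ r := (mem_Ioi.1 hr).le
    rw [norm_mul, norm_pow, Real.norm_of_nonneg hr0, Real.norm_of_nonneg (heat_nonneg _ _)]
    have h := Real.pow_div_factorial_le_exp r hr0 n
    rw [div_le_iff₀ (by positivity)] at h
    rw [one_mul]
    calc r ^ n * heat t (a + r) ≤ Real.exp r * n.factorial * heat t (a + r) :=
          mul_le_mul_of_nonneg_right h (heat_nonneg _ _)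
      _ = _ := by ring

lemma tailMoment_eq_ofReal (ht : 0 < t) (n : ℕ) (a : ℝ) :
    tailMoment n t a = ENNReal.ofReal (2 * ∫ r in Ioi 0, r ^ n * heat t (a + r)) := by
  rw [← integral_const_mul, ofReal_integral_eq_lintegral_ofReal
    ((integrableOn_pow_mul_heat_add ht n a).const_mul 2), tailMoment]
  · refine setLIntegral_congr_fun measurableSet_Ioi fun r hr => ?_
    have hr0 : 0 ≤ r := (mem_Ioi.1 hr).le
    rw [← ENNReal.ofReal_mul (by positivity), mul_assoc]
  · refine (ae_restrict_iff' measurableSet_Ioi).2 (Eventually.of_forall fun r hr => ?_)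
    have hr0 : 0 ≤ r := (mem_Ioi.1 hr).le
    have := heat_nonneg t (a + r)
    simp only [Pi.zero_apply]
    positivity

/-- The moments of the local time at time `t` of a level at distance `a`. -/
noncomputable def limitMoment : ℕ → ℝ → ℝ → ℝ
  | 0, _, _ => 1
  | n + 1, t, a => (tailMoment (n + 1) t a).toReal

lemma limitMoment_nonneg (n : ℕ) (t a : ℝ) : 0 ≤ limitMoment n t a := by
  cases n with
  | zero => exact zero_le_one
  | succ n => exact ENNReal.toReal_nonneg

lemma measurable_limitMoment (n : ℕ) (a : ℝ) : Measurable fun t => limitMoment n t a := by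
  cases n with
  | zero => exact measurable_const
  | succ n => exact (measurable_tailMoment (n + 1) a).ennreal_toReal

/-- For `n = 0` the tail moment misses the atom of mass `erf (a / √(2t))` at zero, which is why
`limitMoment 0` is set to `1` separately. At `a = 0` there is no atom and the two agree, so the
recursion closes. -/
lemma tailMoment_zero (ht : 0 < t) (n : ℕ) :
    tailMoment n t 0 = ENNReal.ofReal (limitMoment n t 0) := by
  cases n with
  | zero =>
    rw [tailMoment_eq_ofReal ht]
    simp only [pow_zero, one_mul, limitMoment]
    rw [two_mul_integral_heat_add ht]
    simp
  | succ n =>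
    rw [limitMoment, ENNReal.ofReal_toReal]
    rw [tailMoment_eq_ofReal ht]
    exact ENNReal.ofReal_ne_top

lemma lintegral_heat_mul_limitMoment (n : ℕ) (ht : 0 < t) (ha : 0 ≤ a) :
    tailMoment (n + 1) t a =
      (n + 1) * ∫⁻ s in Ioo 0 t, ENNReal.ofReal (heat s a * limitMoment n (t - s) 0) := by
  rw [tailMoment_succ n ht ha]
  congr 1
  refine setLIntegral_congr_fun measurableSet_Ioo fun s hs => ?_
  rw [ENNReal.ofReal_mul (heat_nonneg _ _), tailMoment_zero (sub_pos.2 hs.2)]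

lemma measurable_heat_mul_limitMoment (n : ℕ) (t a : ℝ) :
    Measurable fun s => heat s a * limitMoment n (t - s) 0 :=
  (measurable_heat.comp (measurable_id.prodMk measurable_const)).mul
    ((measurable_limitMoment n 0).comp (measurable_const.sub measurable_id))

/-- An infinite integral would make the Gaussian tail moment infinite. At `a = 0` this function is
the dominating one in the limits below. -/
lemma integrableOn_heat_mul_limitMoment (n : ℕ) (ht : 0 < t) (ha : 0 ≤ a) :
    IntegrableOn (fun s => heat s a * limitMoment n (t - s) 0) (Ioo 0 t) := by
  refine ⟨(measurable_heat_mul_limitMoment n t a).aestronglyMeasurable, ?_⟩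
  rw [hasFiniteIntegral_iff_ofReal (Eventually.of_forall fun s =>
    mul_nonneg (heat_nonneg _ _) (limitMoment_nonneg _ _ _)), lt_top_iff_ne_top]
  intro htop
  have h := lintegral_heat_mul_limitMoment n ht ha
  rw [htop, tailMoment_eq_ofReal ht, ENNReal.mul_top (by simp)] at h
  exact ENNReal.ofReal_ne_top h

lemma limitMoment_succ (n : ℕ) (ht : 0 < t) (ha : 0 ≤ a) :
    limitMoment (n + 1) t a =
      (n + 1) * ∫ s in Ioo 0 t, heat s a * limitMoment n (t - s) 0 := by
  rw [limitMoment, lintegral_heat_mul_limitMoment n ht ha, ENNReal.toReal_mul,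
    integral_eq_lintegral_of_nonneg_ae (Eventually.of_forall fun s =>
      mul_nonneg (heat_nonneg _ _) (limitMoment_nonneg _ _ _))
      (measurable_heat_mul_limitMoment n t a).aestronglyMeasurable]
  congr 1

/-- The exponential generating function of the moments of the local time. -/
lemma hasSum_limitMoment (ht : 0 < t) (a : ℝ) (hθ : 0 ≤ θ) :
    HasSum (fun n : ℕ => θ ^ n / n.factorial * limitMoment n t a)
      (erf (a / √(2 * t)) +
        Real.exp (-θ * a + θ ^ 2 * t / 2) * (1 - erf ((a - θ * t) / √(2 * t)))) := by
  have hexp : ∀ r : ℝ, HasSum (fun n : ℕ => θ ^ n / n.factorial * (r ^ n * heat t (a + r)))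
      (heat t (a + r) * Real.exp (θ * r)) := fun r => by
    have h := (NormedSpace.expSeries_div_hasSum_exp (θ * r)).mul_left (heat t (a + r))
    rw [← Real.exp_eq_exp_ℝ] at h
    refine h.congr_fun fun n => ?_
    rw [mul_pow]
    ring
  have h := hasSum_integral_of_dominated_convergence (μ := volume.restrict (Ioi (0 : ℝ)))
    (F := fun (n : ℕ) r => θ ^ n / n.factorial * (r ^ n * heat t (a + r)))
    (f := fun r => heat t (a + r) * Real.exp (θ * r))
    (fun (n : ℕ) r => θ ^ n / n.factorial * (r ^ n * heat t (a + r)))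
    (fun n => ((integrableOn_pow_mul_heat_add ht n a).const_mul _).1)
    (fun n => (ae_restrict_iff' measurableSet_Ioi).2 (Eventually.of_forall fun r hr => by
      have hr0 : 0 ≤ r := (mem_Ioi.1 hr).le
      have := heat_nonneg t (a + r)
      rw [Real.norm_of_nonneg (by positivity)]))
    (Eventually.of_forall fun r => (hexp r).summable)
    (by
      simp_rw [fun r => (hexp r).tsum_eq]
      exact integrableOn_heat_add_mul_exp ht a θ)
    (Eventually.of_forall hexp)
  have h2 := h.mul_left 2
  rw [two_mul_integral_heat_add_mul_exp ht] at h2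
  -- The contribution of the atom at zero, visible only in the zeroth moment.
  have h3 : HasSum (fun n : ℕ => if n = 0 then erf (a / √(2 * t)) else 0) (erf (a / √(2 * t))) :=
    hasSum_ite_eq 0 _
  refine (h3.add h2).congr_fun fun n => ?_
  simp_rw [integral_const_mul]
  cases n with
  | zero =>
    simp only [limitMoment, pow_zero, Nat.factorial_zero, Nat.cast_one, div_one, one_mul, if_true]
    rw [two_mul_integral_heat_add ht]
    ring
  | succ n =>
    rw [if_neg (Nat.succ_ne_zero n), limitMoment, tailMoment_eq_ofReal ht, ENNReal.toReal_ofReal]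
    · ring
    · refine mul_nonneg zero_le_two (setIntegral_nonneg measurableSet_Ioi fun r hr => ?_)
      have hr0 : 0 ≤ r := (mem_Ioi.1 hr).le
      have := heat_nonneg t (a + r)
      positivity

end limit_moments

/-! ### Moments of the normalized occupation times and their limits. -/

/-- The normalized indicator `ε⁻¹ 1_{[0, ε]}`. -/
noncomputable def box (ε : ℝ) (w : ℝ) : ℝ := ε⁻¹ * (Icc 0 ε).indicator (fun _ => (1 : ℝ)) w

lemma measurable_box (ε : ℝ) : Measurable (box ε) :=
  (measurable_const.indicator measurableSet_Icc).const_mul _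

lemma box_nonneg {ε : ℝ} (hε : 0 < ε) (w : ℝ) : 0 ≤ box ε w :=
  mul_nonneg (inv_nonneg.2 hε.le) (indicator_nonneg (fun _ _ => zero_le_one) _)

lemma abs_box_le {ε : ℝ} (hε : 0 < ε) (w : ℝ) : |box ε w| ≤ ε⁻¹ := by
  rw [abs_of_nonneg (box_nonneg hε w), box]
  refine mul_le_of_le_one_right (inv_nonneg.2 hε.le) ?_
  exact indicator_le_self' (fun _ _ => zero_le_one) w

/-- Gaussian average of a function against a normalized indicator. -/
lemma integral_box_mul_gaussian {ε s : ℝ} (hε : 0 < ε) (hs : 0 < s) (y : ℝ) (h : ℝ → ℝ) :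
    ∫ z, box ε (y + z) * h (y + z) ∂(gaussianReal 0 s.toNNReal) =
      ∫ ζ in Ioc (0 : ℝ) 1, heat s (ε * ζ - y) * h (ε * ζ) := by
  rw [integral_gaussianReal_eq_integral_smul (by simpa using hs)]
  have hpdf : ∀ z, gaussianPDFReal 0 s.toNNReal z = heat s z := fun z => by
    rw [gaussianPDFReal, heat, sub_zero, Real.coe_toNNReal _ hs.le]
  simp_rw [hpdf, smul_eq_mul]
  have h1 := integral_add_left_eq_self (μ := volume)
    (fun w => heat s (w - y) * (box ε w * h w)) y
  simp only [add_sub_cancel_left] at h1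
  rw [h1]
  have h2 : ∀ w, heat s (w - y) * (box ε w * h w) =
      (Icc 0 ε).indicator (fun w => ε⁻¹ * (heat s (w - y) * h w)) w := fun w => by
    by_cases hw : w ∈ Icc 0 ε
    · simp only [box, indicator_of_mem hw]; ring
    · simp only [box, indicator_of_notMem hw]; ring
  simp_rw [h2]
  -- The substitution `w = ε ζ` moves `ε` from the domain into the integrand, ready for dominated
  -- convergence.
  rw [integral_indicator measurableSet_Icc, integral_const_mul, integral_Icc_eq_integral_Ioc,
    ← intervalIntegral.integral_of_le hε.le, ← intervalIntegral.integral_of_le zero_le_one,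
    intervalIntegral.integral_comp_mul_left (fun w => heat s (w - y) * h w) hε.ne']
  simp

section box_moments

variable {Ω : Type*} [MeasurableSpace Ω] {P : Measure Ω} [IsProbabilityMeasure P]
  {W : ℝ≥0 → Ω → ℝ} {ε t : ℝ}

lemma IsRegularBM.moment_box_succ (hW : IsRegularBM W P) (hε : 0 < ε) (n : ℕ) (ht : 0 ≤ t)
    (y : ℝ) : moment P (box ε) W (n + 1) t y = (n + 1) * ∫ s in Ioo 0 t, ∫ ζ in Ioc (0 : ℝ) 1,
      heat s (ε * ζ - y) * moment P (box ε) W n (t - s) (ε * ζ) := by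
  rw [hW.moment_succ (measurable_box ε) (abs_box_le hε) n ht,
    intervalIntegral.integral_of_le ht, integral_Ioc_eq_integral_Ioo]
  congr 1
  exact setIntegral_congr_fun measurableSet_Ioo fun s hs =>
    integral_box_mul_gaussian hε hs.1 y (moment P (box ε) W n (t - s))

omit [IsProbabilityMeasure P] in
lemma moment_box_nonneg (hε : 0 < ε) (n : ℕ) (ht : 0 ≤ t) (y : ℝ) :
    0 ≤ moment P (box ε) W n t y :=
  integral_nonneg fun _ => pow_nonneg (intervalIntegral.integral_nonneg ht
    fun _ _ => box_nonneg hε _) n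

omit [IsProbabilityMeasure P] in
lemma norm_inner_box_le {n : ℕ} (hε : 0 < ε)
    (hle : ∀ {t : ℝ}, 0 < t → ∀ y, moment P (box ε) W n t y ≤ limitMoment n t 0)
    {s : ℝ} (hs : s ∈ Ioo 0 t) (y ζ : ℝ) :
    ‖heat s (ε * ζ - y) * moment P (box ε) W n (t - s) (ε * ζ)‖ ≤
      heat s 0 * limitMoment n (t - s) 0 := by
  have hts := sub_pos.2 hs.2
  rw [Real.norm_of_nonneg (mul_nonneg (heat_nonneg _ _) (moment_box_nonneg hε n hts.le _))]
  exact mul_le_mul (heat_le hs.1.le _) (hle hts _) (moment_box_nonneg hε n hts.le _)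
    (heat_nonneg _ _)

omit [IsProbabilityMeasure P] in
lemma norm_integral_inner_box_le {n : ℕ} (hε : 0 < ε)
    (hle : ∀ {t : ℝ}, 0 < t → ∀ y, moment P (box ε) W n t y ≤ limitMoment n t 0)
    {s : ℝ} (hs : s ∈ Ioo 0 t) (y : ℝ) :
    ‖∫ ζ in Ioc (0 : ℝ) 1, heat s (ε * ζ - y) * moment P (box ε) W n (t - s) (ε * ζ)‖ ≤
      heat s 0 * limitMoment n (t - s) 0 := by
  have h := norm_integral_le_of_norm_le_const (μ := volume.restrict (Ioc (0 : ℝ) 1))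
    (Eventually.of_forall fun ζ => norm_inner_box_le (W := W) (P := P) hε hle hs y ζ)
  simpa using h

/-- The kernel is largest at `0`, so by induction the recursion is dominated by the one for the
limit at distance `0`. The bound is uniform in `ε` and `y` and serves both the recursion and the
exponential series. -/
lemma IsRegularBM.moment_box_le (hW : IsRegularBM W P) (hε : 0 < ε) (n : ℕ) :
    ∀ {t : ℝ}, 0 < t → ∀ y, moment P (box ε) W n t y ≤ limitMoment n t 0 := by
  induction n with
  | zero => intro t _ y; simp [moment, limitMoment]
  | succ n ih =>
    intro t ht y
    rw [hW.moment_box_succ hε n ht.le, limitMoment_succ n ht le_rfl]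
    refine mul_le_mul_of_nonneg_left ?_ (by positivity)
    refine (le_abs_self _).trans ?_
    exact norm_integral_le_of_norm_le (integrableOn_heat_mul_limitMoment n ht le_rfl)
      ((ae_restrict_iff' measurableSet_Ioo).2 (Eventually.of_forall fun s hs =>
        norm_integral_inner_box_le hε ih hs y))

lemma IsRegularBM.measurable_inner_box (hW : IsRegularBM W P) (n : ℕ) (ε t y : ℝ) :
    Measurable fun p : ℝ × ℝ =>
      heat p.1 (ε * p.2 - y) * moment P (box ε) W n (t - p.1) (ε * p.2) := by
  refine Measurable.mul ?_ ?_
  · exact measurable_heat.comp (measurable_fst.prodMk ((measurable_snd.const_mul ε).sub_const y))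
  · exact (hW.measurable_moment (measurable_box ε) n).comp
      ((measurable_fst.const_sub t).prodMk (measurable_snd.const_mul ε))

/-- Convergence of the moments of the normalized occupation times. -/
lemma IsRegularBM.tendsto_moment_box (hW : IsRegularBM W P) {e : ℕ → ℝ} (he : ∀ j, 0 < e j)
    (he0 : Tendsto e atTop (𝓝 0)) (n : ℕ) : ∀ {t : ℝ}, 0 < t → ∀ {u : ℕ → ℝ} {y : ℝ},
      Tendsto u atTop (𝓝 y) →
      Tendsto (fun j => moment P (box (e j)) W n t (u j)) atTop (𝓝 (limitMoment n t |y|)) := by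
  -- The starting points `u j` must be allowed to vary: the recursion uses the induction hypothesis
  -- at `e j * ζ`, which tends to `0`.
  induction n with
  | zero => intros; simp [moment, limitMoment]
  | succ n ih =>
    intro t ht u y hu
    simp_rw [fun j => hW.moment_box_succ (he j) n ht.le]
    rw [limitMoment_succ n ht (abs_nonneg y)]
    refine Tendsto.const_mul _ ?_
    refine tendsto_integral_of_dominated_convergence
      (fun s => heat s 0 * limitMoment n (t - s) 0) (fun j => ?_)
      (integrableOn_heat_mul_limitMoment n ht le_rfl) (fun j => ?_) ?_
    · exact ((hW.measurable_inner_box n (e j) t (u j)).stronglyMeasurable.integral_prod_right'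
        (ν := volume.restrict (Ioc (0 : ℝ) 1))).aestronglyMeasurable
    · exact (ae_restrict_iff' measurableSet_Ioo).2 (Eventually.of_forall fun s hs =>
        norm_integral_inner_box_le (he j) (hW.moment_box_le (he j) n) hs (u j))
    · refine (ae_restrict_iff' measurableSet_Ioo).2 (Eventually.of_forall fun s hs => ?_)
      have hconst : heat s |y| * limitMoment n (t - s) 0 =
          ∫ _ζ in Ioc (0 : ℝ) 1, heat s |y| * limitMoment n (t - s) 0 := by simp
      rw [hconst]
      refine tendsto_integral_of_dominated_convergence
        (fun _ => heat s 0 * limitMoment n (t - s) 0) (fun j => ?_)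
        (integrable_const _) (fun j => ?_) (Eventually.of_forall fun ζ => ?_)
      · exact ((hW.measurable_inner_box n (e j) t (u j)).comp
          measurable_prodMk_left).aestronglyMeasurable
      · exact Eventually.of_forall fun ζ =>
          norm_inner_box_le (he j) (hW.moment_box_le (he j) n) hs (u j) ζ
      · have h0 : Tendsto (fun j => e j * ζ) atTop (𝓝 0) := by simpa using he0.mul_const ζ
        have h1 := ih (sub_pos.2 hs.2) h0
        rw [abs_zero] at h1
        have h2 := ((continuous_heat s).tendsto (0 - y)).comp (h0.sub hu)
        have h3 : heat s (0 - y) = heat s |y| := by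
          rw [zero_sub, heat_neg]
          rcases abs_choice y with h | h <;> rw [h]
          rw [heat_neg]
        rw [h3] at h2
        exact h2.mul h1

/-- The functional is bounded by `C * |t|`, so the exponential series integrates term by term. -/
lemma IsRegularBM.hasSum_exp_additive (hW : IsRegularBM W P) {V : ℝ → ℝ} {C : ℝ}
    (hV : Measurable V) (hC : ∀ x, |V x| ≤ C) (θ t y : ℝ) :
    HasSum (fun n : ℕ => θ ^ n / n.factorial * moment P V W n t y)
      (∫ ω, Real.exp (θ * additive V W t y ω) ∂P) := by
  have hb : ∀ n : ℕ, ∀ ω, ‖θ ^ n / n.factorial * additive V W t y ω ^ n‖ ≤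
      (|θ| * (C * |t|)) ^ n / n.factorial := fun n ω => by
    rw [norm_mul, norm_div, norm_pow, norm_pow, Real.norm_natCast, mul_pow, div_mul_eq_mul_div]
    refine div_le_div_of_nonneg_right ?_ (by positivity)
    refine mul_le_mul_of_nonneg_left ?_ (by positivity)
    exact pow_le_pow_left₀ (norm_nonneg _) (abs_additive_le hC y ω) n
  have h := hasSum_integral_of_dominated_convergence (μ := P)
    (F := fun (n : ℕ) ω => θ ^ n / n.factorial * additive V W t y ω ^ n)
    (f := fun ω => Real.exp (θ * additive V W t y ω))
    (fun (n : ℕ) _ => (|θ| * (C * |t|)) ^ n / n.factorial)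
    (fun n => ((hW.integrable_additive_pow hV hC n t y).const_mul _).1)
    (fun n => Eventually.of_forall (hb n))
    (Eventually.of_forall fun _ => Real.summable_pow_div_factorial _)
    (integrable_const _)
    (Eventually.of_forall fun ω => by
      have h := NormedSpace.expSeries_div_hasSum_exp (θ * additive V W t y ω)
      rw [← Real.exp_eq_exp_ℝ] at h
      refine h.congr_fun fun n => ?_
      rw [mul_pow]
      ring)
  simp only [integral_const_mul] at h
  exact h

/-- The limit of the exponential moments of the normalized occupation times. -/
noncomputable def limitMGF (θ t a : ℝ) : ℝ :=
  erf (a / √(2 * t)) + Real.exp (-θ * a + θ ^ 2 * t / 2) * (1 - erf ((a - θ * t) / √(2 * t)))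

lemma IsRegularBM.integral_exp_box_le (hW : IsRegularBM W P) (hε : 0 < ε) (ht : 0 < t) {θ : ℝ}
    (hθ : 0 ≤ θ) (y : ℝ) :
    ∫ ω, Real.exp (θ * additive (box ε) W t y ω) ∂P ≤ limitMGF θ t 0 :=
  hasSum_le (fun n => mul_le_mul_of_nonneg_left (hW.moment_box_le hε n ht y) (by positivity))
    (hW.hasSum_exp_additive (measurable_box ε) (abs_box_le hε) θ t y) (hasSum_limitMoment ht 0 hθ)

lemma IsRegularBM.tendsto_integral_exp_box (hW : IsRegularBM W P) (ht : 0 < t) {θ : ℝ}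
    (hθ : 0 ≤ θ) {e : ℕ → ℝ} (he : ∀ j, 0 < e j) (he0 : Tendsto e atTop (𝓝 0)) (y : ℝ) :
    Tendsto (fun j => ∫ ω, Real.exp (θ * additive (box (e j)) W t y ω) ∂P) atTop
      (𝓝 (limitMGF θ t |y|)) := by
  have h := tendsto_tsum_of_dominated_convergence (𝓕 := atTop)
    (f := fun j (n : ℕ) => θ ^ n / n.factorial * moment P (box (e j)) W n t y)
    (hasSum_limitMoment ht 0 hθ).summable
    (fun n => (hW.tendsto_moment_box he he0 n ht (tendsto_const_nhds (x := y))).const_mul _)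
    (Eventually.of_forall fun j n => by
      rw [Real.norm_of_nonneg (mul_nonneg (by positivity) (moment_box_nonneg (he j) n ht.le y))]
      exact mul_le_mul_of_nonneg_left (hW.moment_box_le (he j) n ht y) (by positivity))
  simp_rw [fun j => (hW.hasSum_exp_additive (measurable_box (e j)) (abs_box_le (he j)) θ t y).tsum_eq]
    at h
  rwa [(hasSum_limitMoment ht |y| hθ).tsum_eq] at h

end box_moments

/-! ### Hölder bounds for the heat kernel. -/

section kernel_bounds

lemma abs_exp_neg_sq_sub_le (u v : ℝ) :
    |Real.exp (-u ^ 2 / 2) - Real.exp (-v ^ 2 / 2)| ≤ |u - v| := by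
  have hd : ∀ x : ℝ, HasDerivAt (fun x : ℝ => Real.exp (-x ^ 2 / 2))
      (Real.exp (-x ^ 2 / 2) * -x) x := fun x => by
    have h1 : HasDerivAt (fun x : ℝ => -x ^ 2 / 2) (-x) x := by
      have := ((hasDerivAt_pow 2 x).neg).div_const 2
      exact this.congr_deriv (by simp; ring)
    exact h1.exp
  have h := Convex.norm_image_sub_le_of_norm_hasDerivWithin_le (C := 1)
    (s := univ) (fun x _ => (hd x).hasDerivWithinAt) (fun x _ => ?_) convex_univ
    (mem_univ v) (mem_univ u)
  · simpa using h
  · rw [norm_mul, norm_neg, Real.norm_of_nonneg (Real.exp_pos _).le, Real.norm_eq_abs]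
    have h1 : |x| ≤ Real.exp (x ^ 2 / 2) := by
      have := Real.add_one_le_exp (x ^ 2 / 2)
      nlinarith [sq_nonneg (|x| - 1), sq_abs x]
    calc Real.exp (-x ^ 2 / 2) * |x| ≤ Real.exp (-x ^ 2 / 2) * Real.exp (x ^ 2 / 2) :=
          mul_le_mul_of_nonneg_left h1 (Real.exp_pos _).le
      _ = 1 := by rw [← Real.exp_add, neg_div, neg_add_cancel, Real.exp_zero]

lemma inv_sqrt_two_pi_mul_le {s : ℝ} (hs : 0 < s) : (√(2 * Real.pi * s))⁻¹ ≤ (√s)⁻¹ := by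
  refine inv_anti₀ (by positivity) (Real.sqrt_le_sqrt ?_)
  nlinarith [Real.pi_gt_three]

lemma heat_zero_le {s : ℝ} (hs : 0 < s) : heat s 0 ≤ s ^ (-(1 / 2) : ℝ) := by
  rw [Real.rpow_neg hs.le, ← Real.sqrt_eq_rpow]
  simpa [heat] using inv_sqrt_two_pi_mul_le hs

/-- Hölder continuity of the heat kernel in space. -/
lemma abs_heat_sub_le {s : ℝ} (hs : 0 < s) (a b : ℝ) :
    |heat s a - heat s b| ≤ s ^ (-(3 / 4) : ℝ) * √|a - b| := by
  have hss : 0 < √s := Real.sqrt_pos.2 hs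
  have harg : ∀ z : ℝ, -z ^ 2 / (2 * s) = -(z / √s) ^ 2 / 2 := fun z => by
    rw [div_pow, Real.sq_sqrt hs.le]
    field_simp
  -- Interpolation between the Lipschitz bound and the bound `1`. The Lipschitz bound alone would
  -- cost `s⁻¹`, not integrable at `0`; the exponent `1/2` costs only `s ^ (-3/4)`.
  have hE : |Real.exp (-(a / √s) ^ 2 / 2) - Real.exp (-(b / √s) ^ 2 / 2)| ≤ √(|a - b| / √s) := by
    have h1 := abs_exp_neg_sq_sub_le (a / √s) (b / √s)
    rw [← sub_div, abs_div, abs_of_pos hss] at h1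
    have hle : ∀ z : ℝ, Real.exp (-z ^ 2 / 2) ≤ 1 := fun z =>
      Real.exp_le_one_iff.2 (by nlinarith [sq_nonneg z])
    have h2 : |Real.exp (-(a / √s) ^ 2 / 2) - Real.exp (-(b / √s) ^ 2 / 2)| ≤ 1 := by
      rw [abs_le]
      constructor <;>
      linarith [hle (a / √s), hle (b / √s), Real.exp_pos (-(a / √s) ^ 2 / 2),
        Real.exp_pos (-(b / √s) ^ 2 / 2)]
    refine Real.le_sqrt_of_sq_le ?_
    rw [sq]
    calc _ ≤ |Real.exp (-(a / √s) ^ 2 / 2) - Real.exp (-(b / √s) ^ 2 / 2)| * 1 :=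
          mul_le_mul_of_nonneg_left h2 (abs_nonneg _)
      _ ≤ _ := by rw [mul_one]; exact h1
  rw [heat, heat, harg, harg, ← mul_sub, abs_mul, abs_of_pos (by positivity)]
  calc _ ≤ (√s)⁻¹ * √(|a - b| / √s) :=
        mul_le_mul (inv_sqrt_two_pi_mul_le hs) hE (abs_nonneg _) (by positivity)
    _ = s ^ (-(3 / 4) : ℝ) * √|a - b| := by
        have h1 : √(√s) = s ^ (1 / 4 : ℝ) := by
          rw [Real.sqrt_eq_rpow (√s), Real.sqrt_eq_rpow s, ← Real.rpow_mul hs.le]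
          norm_num
        rw [Real.sqrt_div (abs_nonneg _), h1, Real.sqrt_eq_rpow s, div_eq_mul_inv (√|a - b|),
          ← Real.rpow_neg hs.le, ← Real.rpow_neg hs.le, mul_left_comm, ← Real.rpow_add hs,
          mul_comm]
        norm_num

lemma integrableOn_rpow_Ioo {p t : ℝ} (hp : -1 < p) :
    IntegrableOn (fun s : ℝ => s ^ p) (Ioo 0 t) :=
  ((intervalIntegral.intervalIntegrable_rpow' (a := 0) (b := t) hp).1).mono_set
    Ioo_subset_Ioc_self

lemma integral_rpow_Ioo_mono {p u t : ℝ} (hp : -1 < p) (hut : u ≤ t) :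
    ∫ s in Ioo 0 u, s ^ p ≤ ∫ s in Ioo 0 t, s ^ p :=
  setIntegral_mono_set (integrableOn_rpow_Ioo hp)
    ((ae_restrict_iff' measurableSet_Ioo).2
      (Eventually.of_forall fun _ hs => Real.rpow_nonneg hs.1.le _))
    (Ioo_subset_Ioo_right hut).eventuallyLE

end kernel_bounds

/-! ### Almost sure convergence of the occupation times along a sequence. -/

section cauchy

variable {Ω : Type*} [MeasurableSpace Ω] {P : Measure Ω} [IsProbabilityMeasure P]
  {W : ℝ≥0 → Ω → ℝ} {ε δ t : ℝ}

lemma measurable_box_sub (ε δ : ℝ) : Measurable fun w => box ε w - box δ w :=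
  (measurable_box ε).sub (measurable_box δ)

lemma abs_box_sub_le (hε : 0 < ε) (hδ : 0 < δ) (w : ℝ) : |box ε w - box δ w| ≤ ε⁻¹ + δ⁻¹ :=
  (abs_sub _ _).trans (add_le_add (abs_box_le hε w) (abs_box_le hδ w))

lemma integral_box_sub_mul_gaussian (hε : 0 < ε) (hδ : 0 < δ) {s : ℝ} (hs : 0 < s) (y : ℝ)
    {h : ℝ → ℝ} (hm : Measurable h) {C : ℝ} (hC : ∀ x, |h x| ≤ C) :
    ∫ z, (box ε (y + z) - box δ (y + z)) * h (y + z) ∂(gaussianReal 0 s.toNNReal) =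
      (∫ ζ in Ioc (0 : ℝ) 1, heat s (ε * ζ - y) * h (ε * ζ)) -
        ∫ ζ in Ioc (0 : ℝ) 1, heat s (δ * ζ - y) * h (δ * ζ) := by
  have hint : ∀ η : ℝ, 0 < η →
      Integrable (fun z => box η (y + z) * h (y + z)) (gaussianReal 0 s.toNNReal) := fun η hη => by
    refine Integrable.of_bound (C := η⁻¹ * C) (((measurable_box η).comp
      (measurable_id.const_add y)).mul (hm.comp (measurable_id.const_add y))).aestronglyMeasurable
      (Eventually.of_forall fun z => ?_)
    rw [norm_mul]
    exact mul_le_mul (abs_box_le hη _) (hC _) (norm_nonneg _) (by positivity)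
  simp_rw [sub_mul]
  rw [integral_sub (hint ε hε) (hint δ hδ), integral_box_mul_gaussian hε hs,
    integral_box_mul_gaussian hδ hs]

/-- The zeroth moment is `1`, so the recursion leaves kernels compared at `ε ζ - y` and `δ ζ - y`,
points at distance at most `|ε - δ|`. -/
lemma IsRegularBM.abs_moment_one_box_sub_le (hW : IsRegularBM W P) (hε : 0 < ε) (hδ : 0 < δ)
    (ht : 0 ≤ t) (y : ℝ) : |moment P (fun w => box ε w - box δ w) W 1 t y| ≤
      (∫ s in Ioo 0 t, s ^ (-(3 / 4) : ℝ)) * √|ε - δ| := by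
  have hsucc := hW.moment_succ (measurable_box_sub ε δ) (abs_box_sub_le hε hδ) 0 ht y
  rw [zero_add] at hsucc
  rw [hsucc, intervalIntegral.integral_of_le ht, integral_Ioc_eq_integral_Ioo,
    Nat.cast_zero, zero_add, one_mul, ← integral_mul_const]
  rw [← Real.norm_eq_abs]
  refine norm_integral_le_of_norm_le (Integrable.mul_const (integrableOn_rpow_Ioo (p := -(3 / 4)) (by norm_num)) _)
    ((ae_restrict_iff' measurableSet_Ioo).2 (Eventually.of_forall fun s hs => ?_))
  have hmom : ∀ u x, moment P (fun w => box ε w - box δ w) W 0 u x = 1 := fun u x => by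
    simp [moment]
  simp_rw [hmom]
  rw [integral_box_sub_mul_gaussian hε hδ hs.1 y (h := fun _ => 1) measurable_const (C := 1)
    (fun _ => by simp)]
  simp only [mul_one]
  have hc : ∀ η : ℝ, IntegrableOn (fun ζ => heat s (η * ζ - y)) (Ioc (0 : ℝ) 1) := fun η => by
    have : Continuous fun ζ => heat s (η * ζ - y) := (continuous_heat s).comp (by fun_prop)
    exact this.integrableOn_Ioc
  rw [← integral_sub (hc ε) (hc δ)]
  have h := norm_setIntegral_le_of_norm_le_const (μ := volume) (s := Ioc (0 : ℝ) 1)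
    (f := fun ζ => heat s (ε * ζ - y) - heat s (δ * ζ - y))
    (C := s ^ (-(3 / 4) : ℝ) * √|ε - δ|) (by simp) fun ζ hζ => by
      refine (abs_heat_sub_le hs.1 _ _).trans ?_
      refine mul_le_mul_of_nonneg_left (Real.sqrt_le_sqrt ?_) (Real.rpow_nonneg hs.1.le _)
      rw [sub_sub_sub_cancel_right, ← sub_mul, abs_mul, abs_of_pos hζ.1]
      exact mul_le_of_le_one_right (abs_nonneg _) hζ.2
  simpa using h

/-- Second moment estimate for the difference of two normalized occupation times. -/
lemma IsRegularBM.exists_moment_two_box_sub_le (hW : IsRegularBM W P) (ht : 0 ≤ t) :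
    ∃ K, 0 ≤ K ∧ ∀ {ε δ : ℝ}, 0 < ε → 0 < δ → ∀ y,
      moment P (fun w => box ε w - box δ w) W 2 t y ≤ K * √|ε - δ| := by
  set I₁ : ℝ := ∫ s in Ioo 0 t, s ^ (-(3 / 4) : ℝ) with hI₁
  set I₂ : ℝ := ∫ s in Ioo 0 t, s ^ (-(1 / 2) : ℝ) with hI₂
  have hI : ∀ p : ℝ, 0 ≤ ∫ s in Ioo 0 t, s ^ p := fun p =>
    setIntegral_nonneg measurableSet_Ioo fun s hs => Real.rpow_nonneg hs.1.le _
  -- One factor `2` is the `n + 1` of the recursion, the other counts the two indicators. Only the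
  -- first moment uses cancellation; the outer kernel is bounded by `s ^ (-1/2)`.
  refine ⟨2 * (I₂ * (2 * I₁)), by have := hI (-(3 / 4)); have := hI (-(1 / 2)); positivity,
    fun {ε δ} hε hδ y => ?_⟩
  set B : ℝ := I₁ * √|ε - δ| with hB
  have hB0 : 0 ≤ B := mul_nonneg (hI _) (Real.sqrt_nonneg _)
  rw [show (2 : ℕ) = 1 + 1 from rfl, hW.moment_succ (measurable_box_sub ε δ)
    (abs_box_sub_le hε hδ) 1 ht, intervalIntegral.integral_of_le ht, integral_Ioc_eq_integral_Ioo]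
  have hkey : |∫ s in Ioo 0 t, ∫ z, (box ε (y + z) - box δ (y + z)) *
      moment P (fun w => box ε w - box δ w) W 1 (t - s) (y + z) ∂(gaussianReal 0 s.toNNReal)| ≤
      ∫ s in Ioo 0 t, s ^ (-(1 / 2) : ℝ) * (2 * B) := by
    rw [← Real.norm_eq_abs]
    refine norm_integral_le_of_norm_le (Integrable.mul_const (integrableOn_rpow_Ioo (p := -(1 / 2)) (by norm_num)) _)
      ((ae_restrict_iff' measurableSet_Ioo).2 (Eventually.of_forall fun s hs => ?_))
    have hm : Measurable fun x => moment P (fun w => box ε w - box δ w) W 1 (t - s) x :=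
      (hW.measurable_moment (measurable_box_sub ε δ) 1).comp measurable_prodMk_left
    have hle : ∀ x, |moment P (fun w => box ε w - box δ w) W 1 (t - s) x| ≤ B := fun x =>
      (hW.abs_moment_one_box_sub_le hε hδ (sub_nonneg.2 hs.2.le) x).trans
        (mul_le_mul_of_nonneg_right (integral_rpow_Ioo_mono (p := -(3 / 4)) (by norm_num) (by linarith [hs.1]))
          (Real.sqrt_nonneg _))
    rw [integral_box_sub_mul_gaussian hε hδ hs.1 y hm hle]
    have hone : ∀ η : ℝ, ‖∫ ζ in Ioc (0 : ℝ) 1, heat s (η * ζ - y) *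
        moment P (fun w => box ε w - box δ w) W 1 (t - s) (η * ζ)‖ ≤ s ^ (-(1 / 2) : ℝ) * B :=
      fun η => by
        have h := norm_setIntegral_le_of_norm_le_const (μ := volume) (s := Ioc (0 : ℝ) 1)
          (f := fun ζ => heat s (η * ζ - y) *
            moment P (fun w => box ε w - box δ w) W 1 (t - s) (η * ζ))
          (C := s ^ (-(1 / 2) : ℝ) * B) (by simp) fun ζ _ => by
            rw [norm_mul, Real.norm_of_nonneg (heat_nonneg _ _)]
            exact mul_le_mul ((heat_le hs.1.le _).trans (heat_zero_le hs.1)) (hle _)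
              (norm_nonneg _) (Real.rpow_nonneg hs.1.le _)
        simpa using h
    refine (norm_sub_le _ _).trans ((add_le_add (hone ε) (hone δ)).trans (le_of_eq ?_))
    ring
  rw [integral_mul_const] at hkey
  have := (le_abs_self _).trans hkey
  have h2 : ((1 : ℕ) : ℝ) + 1 = 2 := by norm_num
  rw [h2]
  calc _ ≤ 2 * (I₂ * (2 * B)) := by linarith
    _ = _ := by rw [hB]; ring

omit [IsProbabilityMeasure P] in
lemma IsRegularBM.additive_box_sub (hW : IsRegularBM W P) (hε : 0 < ε) (hδ : 0 < δ) (t y : ℝ)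
    (ω : Ω) : additive (fun w => box ε w - box δ w) W t y ω =
      additive (box ε) W t y ω - additive (box δ) W t y ω := by
  have hint : ∀ η : ℝ, 0 < η →
      IntervalIntegrable (fun r => box η (y + W r.toNNReal ω)) volume 0 t := fun η hη => by
    have hp : Measurable fun r : ℝ => box η (y + W r.toNNReal ω) := by
      have := hW.continuous_path ω
      exact (measurable_box η).comp (by fun_prop)
    constructor <;>
    exact Integrable.of_bound hp.aestronglyMeasurable η⁻¹
      (Eventually.of_forall fun r => abs_box_le hη _)
  exact intervalIntegral.integral_sub (hint ε hε) (hint δ hδ)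

/-- The occupation times normalized along `ε = (j + 1)⁻⁸` converge almost surely. -/
lemma IsRegularBM.ae_exists_tendsto_box_seq (hW : IsRegularBM W P) (ht : 0 ≤ t) (y : ℝ) :
    ∀ᵐ ω ∂P, ∃ l, Tendsto (fun j : ℕ => additive (box (((j : ℝ) + 1) ^ 8)⁻¹) W t y ω)
      atTop (𝓝 l) := by
  obtain ⟨K, hK0, hK⟩ := hW.exists_moment_two_box_sub_le ht
  -- With exponent `8` the second moment of an increment is of order `(j + 1)⁻⁴`, which stays
  -- summable after weighting by `(j + 1)²`.
  set e : ℕ → ℝ := fun j => (((j : ℝ) + 1) ^ 8)⁻¹ with he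
  have hpos : ∀ j, 0 < e j := fun j => by positivity
  set D : ℕ → Ω → ℝ := fun j ω =>
    additive (box (e (j + 1))) W t y ω - additive (box (e j)) W t y ω with hD
  have hDm : ∀ j, Measurable (D j) := fun j =>
    (hW.measurable_additive (measurable_box _) t y).sub
      (hW.measurable_additive (measurable_box _) t y)
  have hDint : ∀ j, Integrable (fun ω => D j ω ^ 2) P := fun j => by
    have := hW.integrable_additive_pow (measurable_box_sub (e (j + 1)) (e j))
      (abs_box_sub_le (hpos _) (hpos _)) 2 t y
    simpa only [hW.additive_box_sub (hpos (j + 1)) (hpos j) t y] using this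
  have hD2 : ∀ j, ∫ ω, D j ω ^ 2 ∂P ≤ K * (((j : ℝ) + 1) ^ 4)⁻¹ := fun j => by
    have h := hK (hpos (j + 1)) (hpos j) y
    simp only [moment, hW.additive_box_sub (hpos (j + 1)) (hpos j) t y] at h
    refine h.trans (mul_le_mul_of_nonneg_left ?_ hK0)
    have hmono : e (j + 1) ≤ e j := by
      simp only [he]
      gcongr
      simp
    have h1 : |e (j + 1) - e j| ≤ e j := by
      rw [abs_sub_comm, abs_of_nonneg (sub_nonneg.2 hmono)]
      linarith [hpos (j + 1)]
    refine (Real.sqrt_le_sqrt h1).trans (le_of_eq ?_)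
    rw [show e j = ((((j : ℝ) + 1) ^ 4)⁻¹) ^ 2 by simp only [he]; rw [inv_pow, ← pow_mul],
      Real.sqrt_sq (by positivity)]
  have hsq : Summable fun j : ℕ => (((j : ℝ) + 1) ^ 2)⁻¹ := by
    have := (summable_nat_add_iff 1).2 (Real.summable_nat_pow_inv.2 (one_lt_two))
    simpa using this
  have hsum : ∀ᵐ ω ∂P, Summable fun j : ℕ => ((j : ℝ) + 1) ^ 2 * D j ω ^ 2 := by
    have hfin : ∑' j : ℕ, ∫⁻ ω, ENNReal.ofReal (((j : ℝ) + 1) ^ 2 * D j ω ^ 2) ∂P ≠ ⊤ := by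
      have hb : ∀ j : ℕ, ∫⁻ ω, ENNReal.ofReal (((j : ℝ) + 1) ^ 2 * D j ω ^ 2) ∂P ≤
          ENNReal.ofReal (K * (((j : ℝ) + 1) ^ 2)⁻¹) := fun j => by
        rw [← ofReal_integral_eq_lintegral_ofReal ((hDint j).const_mul _)
          (Eventually.of_forall fun ω => by positivity), integral_const_mul]
        refine ENNReal.ofReal_le_ofReal ?_
        refine (mul_le_mul_of_nonneg_left (hD2 j) (by positivity)).trans (le_of_eq ?_)
        field_simp
      refine ne_top_of_le_ne_top ?_ (ENNReal.tsum_le_tsum hb)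
      exact (hsq.mul_left K).tsum_ofReal_ne_top
    rw [← lintegral_tsum fun j => by fun_prop] at hfin
    have hlt := ae_lt_top' (by fun_prop) hfin
    filter_upwards [hlt] with ω hω
    have := ENNReal.summable_toReal hω.ne
    refine this.congr fun j => ?_
    rw [ENNReal.toReal_ofReal (by positivity)]
  filter_upwards [hsum] with ω hω
  -- `|D| ≤ (j + 1)² D² + (j + 1)⁻²`.
  have habs : Summable fun j : ℕ => D j ω := by
    refine Summable.of_norm_bounded (hω.add hsq) fun j => ?_
    have hj : (0 : ℝ) < (j : ℝ) + 1 := by positivity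
    have h1 : ((j : ℝ) + 1) * ((j : ℝ) + 1)⁻¹ = 1 := mul_inv_cancel₀ hj.ne'
    rw [← inv_pow, ← mul_pow, Real.norm_eq_abs]
    have h2 : |D j ω| = |((j : ℝ) + 1) * D j ω| * ((j : ℝ) + 1)⁻¹ := by
      rw [abs_mul, abs_of_pos hj, mul_right_comm, h1, one_mul]
    rw [h2, ← sq_abs (((j : ℝ) + 1) * D j ω)]
    nlinarith [sq_nonneg (|((j : ℝ) + 1) * D j ω| - ((j : ℝ) + 1)⁻¹),
      sq_nonneg (|((j : ℝ) + 1) * D j ω| + ((j : ℝ) + 1)⁻¹)]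
  refine ⟨∑' j, D j ω + additive (box (e 0)) W t y ω, ?_⟩
  have h := habs.hasSum.tendsto_sum_nat.add_const (additive (box (e 0)) W t y ω)
  refine h.congr fun j => ?_
  rw [Finset.sum_range_sub (fun j => additive (box (e j)) W t y ω) j]
  simp [he]

end cauchy

/-- If `ε ↦ ε A(ε)` is monotone, convergence of `A` along `(j + 1)⁻⁸` implies convergence. -/
lemma tendsto_of_tendsto_seq {A : ℝ → ℝ} {l : ℝ}
    (hmono : ∀ {ε δ : ℝ}, 0 < ε → ε ≤ δ → ε * A ε ≤ δ * A δ)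
    (h : Tendsto (fun j : ℕ => A (((j : ℝ) + 1) ^ 8)⁻¹) atTop (𝓝 l)) :
    Tendsto A (𝓝[>] 0) (𝓝 l) := by
  set g : ℕ → ℝ := fun N => A (((N : ℝ) ^ 8)⁻¹) with hg
  have hgl : Tendsto g atTop (𝓝 l) := by
    refine (tendsto_add_atTop_iff_nat 1).1 ?_
    simpa [hg] using h
  -- This choice gives `(N + 1)⁻⁸ ≤ ε ≤ N⁻⁸`, so `A ε` is squeezed between sequence values up to
  -- factors `((N + 1) / N) ^ 8 → 1`.
  set N : ℝ → ℕ := fun ε => ⌊ε ^ (-(1 / 8) : ℝ)⌋₊ with hN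
  have hNt : Tendsto N (𝓝[>] 0) atTop :=
    tendsto_nat_floor_atTop.comp (tendsto_rpow_neg_nhdsGT_zero (by norm_num))
  have hquot : Tendsto (fun n : ℕ => (((n : ℝ) + 1) / n) ^ 8) atTop (𝓝 1) := by
    have h1 : Tendsto (fun n : ℕ => (1 : ℝ) + 1 / n) atTop (𝓝 (1 + 0)) :=
      tendsto_const_nhds.add tendsto_one_div_atTop_nhds_zero_nat
    have h2 := (h1.pow 8)
    rw [add_zero, one_pow] at h2
    refine h2.congr' ?_
    filter_upwards [eventually_gt_atTop 0] with n hn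
    have : (n : ℝ) ≠ 0 := by positivity
    rw [add_div, div_self this]
  have hup : Tendsto (fun n : ℕ => (((n : ℝ) + 1) / n) ^ 8 * g n) atTop (𝓝 l) := by
    simpa using hquot.mul hgl
  have hlow : Tendsto (fun n : ℕ => ((((n : ℝ) + 1) / n) ^ 8)⁻¹ * g (n + 1)) atTop (𝓝 l) := by
    simpa using (hquot.inv₀ one_ne_zero).mul ((tendsto_add_atTop_iff_nat 1).2 hgl)
  have hpos : ∀ᶠ ε in 𝓝[>] (0 : ℝ), 0 < ε ∧ 0 < N ε :=
    (eventually_mem_nhdsWithin.mono fun ε hε => hε).and (hNt.eventually_gt_atTop 0)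
  have hbd : ∀ ε : ℝ, 0 < ε → 0 < N ε →
      (((N ε : ℝ) + 1) ^ 8)⁻¹ ≤ ε ∧ ε ≤ ((N ε : ℝ) ^ 8)⁻¹ := fun ε hε hNε => by
    have hx : (0 : ℝ) < ε ^ (-(1 / 8) : ℝ) := Real.rpow_pos_of_pos hε _
    have h8 : (ε ^ (-(1 / 8) : ℝ)) ^ 8 = ε⁻¹ := by
      rw [← Real.rpow_natCast, ← Real.rpow_mul hε.le]
      norm_num
      rw [Real.rpow_neg_one]
    constructor
    · have := pow_le_pow_left₀ hx.le (Nat.lt_floor_add_one (ε ^ (-(1 / 8) : ℝ))).le 8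
      rw [h8] at this
      exact inv_le_of_inv_le₀ hε this
    · have := pow_le_pow_left₀ (Nat.cast_nonneg _) (Nat.floor_le hx.le) 8
      rw [h8] at this
      exact (le_inv_comm₀ (by positivity) hε).1 this
  -- Nonnegativity is not assumed: `ε * A ε` is monotone and tends to `0` along the sequence.
  have hg0 : ∀ n : ℕ, 0 < n → 0 ≤ g n := fun n hn => by
    by_contra hneg
    push Not at hneg
    have hn8 : (0 : ℝ) < ((n : ℝ) ^ 8)⁻¹ := by positivity
    have hlim : Tendsto (fun m : ℕ => (((m : ℝ)) ^ 8)⁻¹ * g m) atTop (𝓝 (0 * l)) := by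
      refine Tendsto.mul ?_ hgl
      exact tendsto_inv_atTop_zero.comp
        ((tendsto_pow_atTop (by norm_num)).comp tendsto_natCast_atTop_atTop)
    rw [zero_mul] at hlim
    have hle : 0 ≤ ((n : ℝ) ^ 8)⁻¹ * g n := by
      refine le_of_tendsto hlim ?_
      filter_upwards [eventually_ge_atTop n] with m hm
      have hm0 : 0 < m := hn.trans_le hm
      refine hmono (by positivity) ?_
      gcongr
    nlinarith
  refine tendsto_of_tendsto_of_tendsto_of_le_of_le' (hlow.comp hNt) (hup.comp hNt) ?_ ?_
  · filter_upwards [hpos] with ε ⟨hε, hNε⟩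
    obtain ⟨h1, h2⟩ := hbd ε hε hNε
    have hm := hmono (ε := (((N ε : ℝ) + 1) ^ 8)⁻¹) (by positivity) h1
    have hg1 := hg0 (N ε + 1) (Nat.succ_pos _)
    have hgeq : g (N ε + 1) = A (((N ε : ℝ) + 1) ^ 8)⁻¹ := by simp [hg]
    rw [← hgeq] at hm
    simp only [Function.comp]
    have hNpos : (0 : ℝ) < N ε := by exact_mod_cast hNε
    have h3 : ((((N ε : ℝ) + 1) / N ε) ^ 8)⁻¹ = (N ε : ℝ) ^ 8 * (((N ε : ℝ) + 1) ^ 8)⁻¹ := by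
      rw [div_pow, inv_div, div_eq_mul_inv]
    have h4 : (N ε : ℝ) ^ 8 ≤ ε⁻¹ := (le_inv_comm₀ hε (by positivity)).1 h2
    rw [h3, mul_assoc]
    calc (N ε : ℝ) ^ 8 * ((((N ε : ℝ) + 1) ^ 8)⁻¹ * g (N ε + 1)) ≤
          ε⁻¹ * ((((N ε : ℝ) + 1) ^ 8)⁻¹ * g (N ε + 1)) :=
          mul_le_mul_of_nonneg_right h4 (by positivity)
      _ ≤ ε⁻¹ * (ε * A ε) := mul_le_mul_of_nonneg_left hm (by positivity)
      _ = A ε := by field_simp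
  · filter_upwards [hpos] with ε ⟨hε, hNε⟩
    obtain ⟨h1, h2⟩ := hbd ε hε hNε
    have hm := hmono hε h2
    have hg1 := hg0 (N ε) hNε
    simp only [Function.comp]
    have hNpos : (0 : ℝ) < N ε := by exact_mod_cast hNε
    have h4 : ε⁻¹ ≤ ((N ε : ℝ) + 1) ^ 8 := inv_le_of_inv_le₀ (by positivity) h1
    calc A ε = ε⁻¹ * (ε * A ε) := by field_simp
      _ ≤ ε⁻¹ * (((N ε : ℝ) ^ 8)⁻¹ * g (N ε)) := mul_le_mul_of_nonneg_left hm (by positivity)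
      _ ≤ ((N ε : ℝ) + 1) ^ 8 * (((N ε : ℝ) ^ 8)⁻¹ * g (N ε)) :=
          mul_le_mul_of_nonneg_right h4 (by positivity)
      _ = _ := by rw [div_pow, div_eq_mul_inv, mul_assoc]

/-- Convergence of expectations under a bound on second moments. -/
lemma integral_eq_of_tendsto_of_sq_le {Ω : Type*} [MeasurableSpace Ω] {P : Measure Ω}
    [IsProbabilityMeasure P] {X : ℕ → Ω → ℝ} {Y : Ω → ℝ} {c M : ℝ} (hX : ∀ j, Measurable (X j))
    (hX0 : ∀ j ω, 0 ≤ X j ω) (hX2 : ∀ j, Integrable (fun ω => X j ω ^ 2) P)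
    (hM : ∀ j, ∫ ω, X j ω ^ 2 ∂P ≤ M) (hlim : ∀ᵐ ω ∂P, Tendsto (fun j => X j ω) atTop (𝓝 (Y ω)))
    (hc : Tendsto (fun j => ∫ ω, X j ω ∂P) atTop (𝓝 c)) :
    Integrable Y P ∧ ∫ ω, Y ω ∂P = c := by
  have hYm : AEMeasurable Y P := aemeasurable_of_tendsto_metrizable_ae atTop
    (fun j => (hX j).aemeasurable) hlim
  have hY0 : ∀ᵐ ω ∂P, 0 ≤ Y ω := by
    filter_upwards [hlim] with ω hω using ge_of_tendsto' hω fun j => hX0 j ω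
  have hM0 : 0 ≤ M := (integral_nonneg fun ω => sq_nonneg (X 0 ω)).trans (hM 0)
  -- Fatou's lemma carries the second moment bound to the limit.
  have hY2l : ∫⁻ ω, ENNReal.ofReal (Y ω ^ 2) ∂P ≤ ENNReal.ofReal M := by
    have h1 : ∫⁻ ω, ENNReal.ofReal (Y ω ^ 2) ∂P ≤
        liminf (fun j => ∫⁻ ω, ENNReal.ofReal (X j ω ^ 2) ∂P) atTop := by
      refine le_trans (le_of_eq (lintegral_congr_ae ?_))
        (lintegral_liminf_le fun j => ((hX j).pow_const 2).ennreal_ofReal)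
      filter_upwards [hlim] with ω hω
      exact (((ENNReal.continuous_ofReal.tendsto _).comp (hω.pow 2)).liminf_eq).symm
    refine h1.trans (liminf_le_of_le (by isBoundedDefault) fun b hb => ?_)
    obtain ⟨j, hj⟩ := hb.exists
    refine hj.trans ?_
    rw [← ofReal_integral_eq_lintegral_ofReal (hX2 j) (Eventually.of_forall fun ω => sq_nonneg _)]
    exact ENNReal.ofReal_le_ofReal (hM j)
  have hY2 : Integrable (fun ω => Y ω ^ 2) P := by
    refine ⟨(hYm.pow_const 2).aestronglyMeasurable, ?_⟩
    rw [hasFiniteIntegral_iff_ofReal (Eventually.of_forall fun ω => sq_nonneg _)]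
    exact hY2l.trans_lt ENNReal.ofReal_lt_top
  have hYM : ∫ ω, Y ω ^ 2 ∂P ≤ M := by
    rw [← ofReal_integral_eq_lintegral_ofReal hY2 (Eventually.of_forall fun ω => sq_nonneg _)]
      at hY2l
    exact (ENNReal.ofReal_le_ofReal_iff hM0).1 hY2l
  have hint : ∀ {Z : Ω → ℝ}, AEMeasurable Z P → Integrable (fun ω => Z ω ^ 2) P →
      Integrable Z P := fun {Z} hZ hZ2 => by
    refine ((integrable_const (1 : ℝ)).add hZ2).mono' hZ.aestronglyMeasurable
      (Eventually.of_forall fun ω => ?_)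
    rw [Real.norm_eq_abs]
    have := sq_nonneg (|Z ω| - 1)
    simp only [Pi.add_apply]
    nlinarith [sq_abs (Z ω)]
  have hYi : Integrable Y P := hint hYm hY2
  -- Uniform integrability in quantitative form: `0 ≤ Z - min Z K ≤ Z² / K`.
  have htrunc : ∀ {Z : Ω → ℝ} {K : ℝ}, 0 < K → AEMeasurable Z P →
      Integrable (fun ω => Z ω ^ 2) P → (∀ᵐ ω ∂P, 0 ≤ Z ω) → ∫ ω, Z ω ^ 2 ∂P ≤ M →
      |∫ ω, Z ω ∂P - ∫ ω, min (Z ω) K ∂P| ≤ M / K := fun {Z K} hK hZ hZ2 hZ0 hZM => by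
    have hZi := hint hZ hZ2
    have hmin : Integrable (fun ω => min (Z ω) K) P := hZi.inf (integrable_const K)
    rw [← integral_sub hZi hmin, ← Real.norm_eq_abs]
    refine (norm_integral_le_of_norm_le (g := fun ω => Z ω ^ 2 / K) (hZ2.div_const K) ?_).trans ?_
    · filter_upwards [hZ0] with ω hω
      rw [Real.norm_of_nonneg (sub_nonneg.2 (min_le_left _ _)), le_div_iff₀ hK]
      rcases le_total (Z ω) K with h | h
      · rw [min_eq_left h]; nlinarith
      · rw [min_eq_right h]; nlinarith
    · rw [integral_div]
      exact div_le_div_of_nonneg_right hZM hK.le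
  refine ⟨hYi, ?_⟩
  have hclose : ∀ K : ℝ, 0 < K → |c - ∫ ω, Y ω ∂P| ≤ 2 * M / K := fun K hK => by
    have h1 : Tendsto (fun j => ∫ ω, min (X j ω) K ∂P) atTop (𝓝 (∫ ω, min (Y ω) K ∂P)) := by
      refine tendsto_integral_of_dominated_convergence (fun _ => K)
        (fun j => ((hX j).min measurable_const).aestronglyMeasurable) (integrable_const K)
        (fun j => Eventually.of_forall fun ω => ?_) ?_
      · rw [Real.norm_of_nonneg (le_min (hX0 j ω) hK.le)]
        exact min_le_right _ _
      · filter_upwards [hlim] with ω hω using hω.min tendsto_const_nhds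
    have h2 := le_of_tendsto' (hc.sub h1).abs fun j =>
      htrunc hK (hX j).aemeasurable (hX2 j) (Eventually.of_forall (hX0 j)) (hM j)
    have h3 := htrunc hK hYm hY2 hY0 hYM
    rw [abs_sub_comm] at h3
    calc |c - ∫ ω, Y ω ∂P| ≤ |c - ∫ ω, min (Y ω) K ∂P| + |∫ ω, min (Y ω) K ∂P - ∫ ω, Y ω ∂P| :=
          abs_sub_le _ _ _
      _ ≤ M / K + M / K := add_le_add h2 h3
      _ = 2 * M / K := by ring
  have hzero : |c - ∫ ω, Y ω ∂P| ≤ 0 :=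
    ge_of_tendsto (tendsto_const_nhds.div_atTop tendsto_id)
      ((eventually_gt_atTop 0).mono hclose)
  linarith [abs_nonpos_iff.1 hzero]

/-! ### Existence and exponential moments of the local time. -/

section local_time

variable {Ω : Type*} [MeasurableSpace Ω] {P : Measure Ω} [IsProbabilityMeasure P]
  {W : ℝ≥0 → Ω → ℝ}

omit [MeasurableSpace Ω] in
lemma occupation_eq_additive (W : ℝ≥0 → Ω → ℝ) (x t ε : ℝ) (ω : Ω) :
    occupation W x t ε ω = additive (box ε) W t (-x) ω := by
  simp only [occupation, additive, box, intervalIntegral.integral_const_mul]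
  congr 1
  refine intervalIntegral.integral_congr fun r _ => ?_
  have : W r.toNNReal ω ∈ Icc x (x + ε) ↔ -x + W r.toNNReal ω ∈ Icc 0 ε := by
    rw [mem_Icc, mem_Icc]
    constructor <;> rintro ⟨h1, h2⟩ <;> constructor <;> linarith
  by_cases h : W r.toNNReal ω ∈ Icc x (x + ε)
  · simp only [indicator_of_mem h, indicator_of_mem (this.1 h)]
  · simp only [indicator_of_notMem h, indicator_of_notMem (mt this.2 h)]

-- The factor cancels the normalization, leaving the time spent in `[0, ε]`, which grows with `ε`.
omit [MeasurableSpace Ω] in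
lemma mul_additive_box_mono (hc : ∀ ω, Continuous (W · ω)) {t : ℝ} (ht : 0 ≤ t) (y : ℝ) (ω : Ω)
    {ε δ : ℝ} (hε : 0 < ε) (hεδ : ε ≤ δ) :
    ε * additive (box ε) W t y ω ≤ δ * additive (box δ) W t y ω := by
  have hδ := hε.trans_le hεδ
  have hp : Continuous fun r : ℝ => y + W r.toNNReal ω := by
    have := hc ω
    fun_prop
  have hint : ∀ η : ℝ, IntervalIntegrable
      (fun r => (Icc 0 η).indicator (fun _ => (1 : ℝ)) (y + W r.toNNReal ω)) volume 0 t :=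
    fun η => by
      have hm : Measurable fun r : ℝ => (Icc 0 η).indicator (fun _ => (1 : ℝ)) (y + W r.toNNReal ω) :=
        (measurable_const.indicator measurableSet_Icc).comp hp.measurable
      constructor <;>
      exact Integrable.of_bound hm.aestronglyMeasurable 1
        (Eventually.of_forall fun r => (norm_indicator_le_norm_self _ _).trans (by simp))
  simp only [additive, box, intervalIntegral.integral_const_mul]
  rw [mul_inv_cancel_left₀ hε.ne', mul_inv_cancel_left₀ hδ.ne']
  refine intervalIntegral.integral_mono_on ht (hint ε) (hint δ) fun r _ => ?_
  exact indicator_le_indicator_of_subset (Icc_subset_Icc_right hεδ) (fun _ => zero_le_one) _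

lemma ae_tendsto_occupation (hW : IsBrownianReal W P) {t : ℝ} (ht : 0 ≤ t) (x : ℝ) :
    ∀ᵐ ω ∂P, Tendsto (fun ε => occupation W x t ε ω) (𝓝[>] 0) (𝓝 (localTime W x t ω)) := by
  obtain ⟨W', hW', heq⟩ := exists_isRegularBM hW
  filter_upwards [heq, hW'.ae_exists_tendsto_box_seq ht (-x)] with ω hω ⟨l, hl⟩
  have h1 : ∀ ε, occupation W x t ε ω = additive (box ε) W' t (-x) ω := fun ε => by
    rw [← occupation_eq_additive]
    simp only [occupation, hω]
  -- `limUnder` is meaningful only where a limit exists, which is what remains to be shown.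
  refine tendsto_nhds_limUnder ⟨l, ?_⟩
  simp_rw [h1]
  exact tendsto_of_tendsto_seq
    (fun hε hεδ => mul_additive_box_mono hW'.continuous_path ht (-x) ω hε hεδ) hl

/-- The exponential moments of Brownian local time. -/
lemma integral_exp_localTime (hW : IsBrownianReal W P) {t θ : ℝ} (ht : 0 < t) (hθ : 0 ≤ θ)
    (x : ℝ) : Integrable (fun ω => Real.exp (θ * localTime W x t ω)) P ∧
      ∫ ω, Real.exp (θ * localTime W x t ω) ∂P = limitMGF θ t |x| := by
  obtain ⟨W', hW', heq⟩ := exists_isRegularBM hW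
  set e : ℕ → ℝ := fun j => 1 / ((j : ℝ) + 1) with he
  have hpos : ∀ j, 0 < e j := fun j => by positivity
  have he0 : Tendsto e atTop (𝓝 0) := tendsto_one_div_add_atTop_nhds_zero_nat
  have he0' : Tendsto e atTop (𝓝[>] 0) :=
    tendsto_nhdsWithin_iff.2 ⟨he0, Eventually.of_forall hpos⟩
  have hm : ∀ j, Measurable (additive (box (e j)) W' t (-x)) := fun j =>
    hW'.measurable_additive (measurable_box _) t (-x)
  have hsq : ∀ j ω, Real.exp (θ * additive (box (e j)) W' t (-x) ω) ^ 2 =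
      Real.exp (2 * θ * additive (box (e j)) W' t (-x) ω) := fun j ω => by
    rw [← Real.exp_nat_mul]
    push_cast
    ring_nf
  have hlim := hW'.tendsto_integral_exp_box ht hθ hpos he0 (-x)
  rw [abs_neg] at hlim
  -- The square of the exponential is the exponential at `2 * θ`, whose mean is bounded uniformly in
  -- `ε` and in the level.
  refine integral_eq_of_tendsto_of_sq_le
    (X := fun j ω => Real.exp (θ * additive (box (e j)) W' t (-x) ω)) (M := limitMGF (2 * θ) t 0)
    (fun j => ((hm j).const_mul θ).exp) (fun j ω => (Real.exp_pos _).le) (fun j => ?_)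
    (fun j => ?_) ?_ hlim
  · simp_rw [hsq]
    refine Integrable.of_bound ((hm j).const_mul _).exp.aestronglyMeasurable
      (Real.exp (2 * θ * ((e j)⁻¹ * |t|))) (Eventually.of_forall fun ω => ?_)
    rw [Real.norm_of_nonneg (Real.exp_pos _).le, Real.exp_le_exp]
    exact mul_le_mul_of_nonneg_left
      ((le_abs_self _).trans (abs_additive_le (abs_box_le (hpos j)) (-x) ω)) (by positivity)
  · simp_rw [hsq]
    exact hW'.integral_exp_box_le (hpos j) ht (by positivity) (-x)
  · filter_upwards [heq, ae_tendsto_occupation hW ht.le x] with ω hω hL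
    have h1 : ∀ ε, occupation W x t ε ω = additive (box ε) W' t (-x) ω := fun ε => by
      rw [← occupation_eq_additive]
      simp only [occupation, hω]
    simp_rw [h1] at hL
    exact ((Real.continuous_exp.tendsto _).comp ((hL.comp he0').const_mul θ))

end local_time

/-! ### Derivatives of the closed form of the exponential moment. -/

section closed_form

variable {β σ c t z : ℝ}

/-- The normalized distance of `z` to the boundary `c`. -/
noncomputable def levelArg (σ c t z : ℝ) : ℝ := (z - c) / (σ * √(2 * t))

/-- The second summand of the closed form of the exponential moment. -/
noncomputable def tailTerm (β σ c t z : ℝ) : ℝ :=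
  Real.exp (-β * (z - c) + β ^ 2 * σ ^ 2 * t / 2) *
    (1 - erf (levelArg σ c t z - β * σ * √t / √2))

/-- The closed form of the exponential moment. -/
noncomputable def expMoment (β σ c t z : ℝ) : ℝ := erf (levelArg σ c t z) + tailTerm β σ c t z

/-- The space derivative of `erf (levelArg σ c t z)`. -/
noncomputable def levelDensity (σ c t z : ℝ) : ℝ :=
  2 / √Real.pi * Real.exp (-levelArg σ c t z ^ 2) / (σ * √(2 * t))

lemma tailTerm_pos (β σ c t z : ℝ) : 0 < tailTerm β σ c t z :=
  mul_pos (Real.exp_pos _) (sub_pos.2 (erf_lt_one _))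

lemma expMoment_pos (hσ : 0 < σ) (β t : ℝ) (hz : c ≤ z) : 0 < expMoment β σ c t z :=
  add_pos_of_nonneg_of_pos
    (erf_nonneg (div_nonneg (sub_nonneg.2 hz) (by positivity))) (tailTerm_pos _ _ _ _ _)

lemma limitMGF_eq_expMoment (hσ : 0 < σ) (ht : 0 < t) (β z : ℝ) :
    limitMGF (β * σ) t ((z - c) / σ) = expMoment β σ c t z := by
  have h2t : √(2 * t) = √2 * √t := Real.sqrt_mul (by positivity) _
  have hst : √t ^ 2 = t := Real.sq_sqrt ht.le
  have hs2 : √2 ^ 2 = (2 : ℝ) := Real.sq_sqrt (by positivity)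
  have h1 : (z - c) / σ / √(2 * t) = levelArg σ c t z := by rw [levelArg, div_div]
  have h2 : ((z - c) / σ - β * σ * t) / √(2 * t) = levelArg σ c t z - β * σ * √t / √2 := by
    rw [sub_div, h1]
    congr 1
    rw [h2t]
    nth_rewrite 1 [← hst]
    field_simp
  have h3 : -(β * σ) * ((z - c) / σ) + (β * σ) ^ 2 * t / 2 =
      -β * (z - c) + β ^ 2 * σ ^ 2 * t / 2 := by field_simp
  rw [limitMGF, h1, h2, h3, expMoment, tailTerm]

/-- Completing the square: the prefactor of the tail term turns its Gaussian into the one of the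
first error function, so a single density appears in every derivative. -/
lemma exp_mul_exp_levelArg (hσ : 0 < σ) (ht : 0 < t) (β c z : ℝ) :
    Real.exp (-β * (z - c) + β ^ 2 * σ ^ 2 * t / 2) *
      Real.exp (-(levelArg σ c t z - β * σ * √t / √2) ^ 2) =
      Real.exp (-levelArg σ c t z ^ 2) := by
  have h2t : √(2 * t) = √2 * √t := Real.sqrt_mul (by positivity) _
  have hst : √t ^ 2 = t := Real.sq_sqrt ht.le
  have hs2 : √2 ^ 2 = (2 : ℝ) := Real.sq_sqrt (by positivity)
  have h1 : 2 * levelArg σ c t z * (β * σ * √t / √2) = β * (z - c) := by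
    rw [levelArg, h2t]
    field_simp
    rw [hs2]
    ring
  have h2 : (β * σ * √t / √2) ^ 2 = β ^ 2 * σ ^ 2 * t / 2 := by
    rw [div_pow, mul_pow, mul_pow, hst, hs2]
  rw [← Real.exp_add]
  congr 1
  linear_combination h1 - h2

lemma hasDerivAt_levelArg (σ c t z : ℝ) :
    HasDerivAt (fun y => levelArg σ c t y) (1 / (σ * √(2 * t))) z :=
  ((hasDerivAt_id z).sub_const c).div_const _

lemma hasDerivAt_tailTerm (hσ : 0 < σ) (ht : 0 < t) (β c z : ℝ) :
    HasDerivAt (fun y => tailTerm β σ c t y)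
      (-(β * tailTerm β σ c t z) - levelDensity σ c t z) z := by
  have h1 : HasDerivAt (fun y => -β * (y - c) + β ^ 2 * σ ^ 2 * t / 2) (-β) z := by
    have := (((hasDerivAt_id z).sub_const c).const_mul (-β)).add_const (β ^ 2 * σ ^ 2 * t / 2)
    exact this.congr_deriv (by ring)
  have h2 := (hasDerivAt_erf _).comp z
    ((hasDerivAt_levelArg σ c t z).sub_const (β * σ * √t / √2))
  have h3 := h1.exp.mul (h2.const_sub 1)
  refine h3.congr_deriv ?_
  have e := exp_mul_exp_levelArg hσ ht β c z
  simp only [tailTerm, levelDensity, Function.comp]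
  rw [← e]
  ring

/-- The densities from the two error functions cancel. -/
lemma hasDerivAt_expMoment (hσ : 0 < σ) (ht : 0 < t) (β c z : ℝ) :
    HasDerivAt (fun y => expMoment β σ c t y) (-(β * tailTerm β σ c t z)) z := by
  have h := ((hasDerivAt_erf _).comp z (hasDerivAt_levelArg σ c t z)).add
    (hasDerivAt_tailTerm hσ ht β c z)
  refine h.congr_deriv ?_
  rw [levelDensity]
  ring

/-- The derivative equals `σ² / 2` times the second space derivative: this is the heat equation for
the exponential moment. -/
lemma hasDerivAt_expMoment_time (hσ : 0 < σ) (ht : 0 < t) (β c z : ℝ) :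
    HasDerivAt (fun s => expMoment β σ c s z)
      (β * σ ^ 2 / 2 * (β * tailTerm β σ c t z + levelDensity σ c t z)) t := by
  have h2t : √(2 * t) = √2 * √t := Real.sqrt_mul (by positivity) _
  have hs2 : √2 ^ 2 = (2 : ℝ) := Real.sq_sqrt (by positivity)
  -- The value of `A` is immaterial, since it cancels between the two error functions.
  obtain ⟨A, hA⟩ : ∃ A, HasDerivAt (fun s => levelArg σ c s z) A t := by
    have h1 : HasDerivAt (fun s : ℝ => σ * √(2 * s)) _ t :=
      (((hasDerivAt_id t).const_mul 2).sqrt (by simpa using ht.ne')).const_mul σ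
    exact ⟨_, (hasDerivAt_const t (z - c)).div h1 (by positivity)⟩
  have hB : HasDerivAt (fun s => levelArg σ c s z - β * σ * √s / √2)
      (A - β * σ / (2 * √(2 * t))) t := by
    have h1 := hA.sub (((Real.hasDerivAt_sqrt ht.ne').const_mul (β * σ)).div_const √2)
    refine h1.congr_deriv ?_
    rw [h2t]
    field_simp
  have hE : HasDerivAt (fun s => -β * (z - c) + β ^ 2 * σ ^ 2 * s / 2) (β ^ 2 * σ ^ 2 / 2) t := by
    have := (((hasDerivAt_id t).const_mul (β ^ 2 * σ ^ 2)).div_const 2).const_add (-β * (z - c))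
    exact this.congr_deriv (by ring)
  have h := ((hasDerivAt_erf _).comp t hA).add
    (hE.exp.mul (((hasDerivAt_erf _).comp t hB).const_sub 1))
  refine h.congr_deriv ?_
  have e := exp_mul_exp_levelArg hσ ht β c z
  simp only [tailTerm, levelDensity, Function.comp]
  rw [← e]
  field_simp
  ring

lemma continuousOn_levelArg (hσ : 0 < σ) (T c : ℝ) :
    ContinuousOn (fun p : ℝ × ℝ => levelArg σ c p.1 p.2) (Ioc 0 T ×ˢ Ici c) := by
  refine ContinuousOn.div (by fun_prop) (by fun_prop) fun p hp => ?_
  have : 0 < p.1 := hp.1.1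
  positivity

lemma continuousOn_tailTerm (hσ : 0 < σ) (β T c : ℝ) :
    ContinuousOn (fun p : ℝ × ℝ => tailTerm β σ c p.1 p.2) (Ioc 0 T ×ˢ Ici c) := by
  refine ContinuousOn.mul (Continuous.continuousOn (by fun_prop)) (continuousOn_const.sub ?_)
  exact continuous_erf.comp_continuousOn
    ((continuousOn_levelArg hσ T c).sub (Continuous.continuousOn (by fun_prop)))

lemma continuousOn_expMoment (hσ : 0 < σ) (β T c : ℝ) :
    ContinuousOn (fun p : ℝ × ℝ => expMoment β σ c p.1 p.2) (Ioc 0 T ×ˢ Ici c) :=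
  (continuous_erf.comp_continuousOn (continuousOn_levelArg hσ T c)).add
    (continuousOn_tailTerm hσ β T c)

lemma continuousOn_levelDensity (hσ : 0 < σ) (T c : ℝ) :
    ContinuousOn (fun p : ℝ × ℝ => levelDensity σ c p.1 p.2) (Ioc 0 T ×ˢ Ici c) := by
  refine ContinuousOn.div ?_ (by fun_prop) fun p hp => ?_
  · exact continuousOn_const.mul
      (Real.continuous_exp.comp_continuousOn ((continuousOn_levelArg hσ T c).pow 2).neg)
  · have : 0 < p.1 := hp.1.1
    positivity

end closed_form

/-! ### The Cole–Hopf transformation. -/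

section pde

variable {β σ c : ℝ} {u : ℝ → ℝ → ℝ}

lemma hasDerivAt_log_expMoment (hσ : 0 < σ) (hβ : β ≠ 0) {t z : ℝ} (ht : 0 < t) (hz : c ≤ z) :
    HasDerivAt (fun y => 1 / β * Real.log (expMoment β σ c t y))
      (-(tailTerm β σ c t z / expMoment β σ c t z)) z := by
  have h := ((hasDerivAt_expMoment hσ ht β c z).log (expMoment_pos hσ β t hz).ne').const_mul (1 / β)
  refine h.congr_deriv ?_
  field_simp

lemma hasDerivAt_log_expMoment_time (hσ : 0 < σ) (hβ : β ≠ 0) {t z : ℝ} (ht : 0 < t)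
    (hz : c ≤ z) : HasDerivAt (fun s => 1 / β * Real.log (expMoment β σ c s z))
      (σ ^ 2 / 2 * ((β * tailTerm β σ c t z + levelDensity σ c t z) / expMoment β σ c t z)) t := by
  have h := ((hasDerivAt_expMoment_time hσ ht β c z).log
    (expMoment_pos hσ β t hz).ne').const_mul (1 / β)
  refine h.congr_deriv ?_
  field_simp

lemma hasDerivAt_ratio (hσ : 0 < σ) (β : ℝ) {t z : ℝ} (ht : 0 < t) (hz : c ≤ z) :
    HasDerivAt (fun y => -(tailTerm β σ c t y / expMoment β σ c t y))
      ((β * tailTerm β σ c t z + levelDensity σ c t z) / expMoment β σ c t z -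
        β * (tailTerm β σ c t z / expMoment β σ c t z) ^ 2) z := by
  have hF := (expMoment_pos hσ β t hz).ne'
  have h := ((hasDerivAt_tailTerm hσ ht β c z).div (hasDerivAt_expMoment hσ ht β c z) hF).neg
  refine h.congr_deriv ?_
  field_simp
  ring

variable (hu : ∀ t, 0 < t → ∀ z ∈ Ici c, u t z = 1 / β * Real.log (expMoment β σ c t z))
include hu

lemma hasDerivWithinAt_space (hσ : 0 < σ) (hβ : β ≠ 0) {t z : ℝ} (ht : 0 < t) (hz : z ∈ Ici c) :
    HasDerivWithinAt (fun y => u t y) (-(tailTerm β σ c t z / expMoment β σ c t z)) (Ici c) z :=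
  (hasDerivAt_log_expMoment hσ hβ ht hz).hasDerivWithinAt.congr (fun y hy => hu t ht y hy)
    (hu t ht z hz)

lemma dz_eq (hσ : 0 < σ) (hβ : β ≠ 0) {t z : ℝ} (ht : 0 < t) (hz : z ∈ Ici c) :
    dz c u t z = -(tailTerm β σ c t z / expMoment β σ c t z) :=
  (hasDerivWithinAt_space hu hσ hβ ht hz).derivWithin (uniqueDiffOn_Ici c z hz)

lemma hasDerivWithinAt_space_space (hσ : 0 < σ) (hβ : β ≠ 0) {t z : ℝ} (ht : 0 < t)
    (hz : z ∈ Ici c) : HasDerivWithinAt (fun y => dz c u t y)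
      ((β * tailTerm β σ c t z + levelDensity σ c t z) / expMoment β σ c t z -
        β * (tailTerm β σ c t z / expMoment β σ c t z) ^ 2) (Ici c) z :=
  (hasDerivAt_ratio hσ β ht hz).hasDerivWithinAt.congr (fun _ hy => dz_eq hu hσ hβ ht hy)
    (dz_eq hu hσ hβ ht hz)

lemma dzz_eq (hσ : 0 < σ) (hβ : β ≠ 0) {t z : ℝ} (ht : 0 < t) (hz : z ∈ Ici c) :
    dzz c u t z = (β * tailTerm β σ c t z + levelDensity σ c t z) / expMoment β σ c t z -
        β * (tailTerm β σ c t z / expMoment β σ c t z) ^ 2 :=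
  (hasDerivWithinAt_space_space hu hσ hβ ht hz).derivWithin (uniqueDiffOn_Ici c z hz)

lemma hasDerivAt_time (hσ : 0 < σ) (hβ : β ≠ 0) {t z : ℝ} (ht : 0 < t) (hz : z ∈ Ici c) :
    HasDerivAt (fun s => u s z)
      (σ ^ 2 / 2 * ((β * tailTerm β σ c t z + levelDensity σ c t z) / expMoment β σ c t z)) t :=
  -- The formula for `u` holds at all positive times, also beyond `T`, so the time derivative at `t
  -- = T` is two-sided.
  (hasDerivAt_log_expMoment_time hσ hβ ht hz).congr_of_eventuallyEq
    ((eventually_gt_nhds ht).mono fun s hs => hu s hs z hz)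

lemma isC12_of_eq (hσ : 0 < σ) (hβ : β ≠ 0) (T : ℝ) : IsC12 T c u := by
  have hF := continuousOn_expMoment hσ β T c
  have hG := continuousOn_tailTerm hσ β T c
  have hg := continuousOn_levelDensity hσ T c
  have hne : ∀ p ∈ Ioc 0 T ×ˢ Ici c, expMoment β σ c p.1 p.2 ≠ 0 := fun p hp =>
    (expMoment_pos hσ β p.1 hp.2).ne'
  have hq := ((continuousOn_const (c := β)).mul hG |>.add hg).div hF hne
  refine ⟨fun t ht z hz => (hasDerivAt_time hu hσ hβ ht.1 hz).differentiableAt,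
    fun t ht z hz => (hasDerivWithinAt_space hu hσ hβ ht.1 hz).differentiableWithinAt,
    fun t ht z hz => (hasDerivWithinAt_space_space hu hσ hβ ht.1 hz).differentiableWithinAt,
    ?_, ?_, ?_, ?_⟩
  · exact (continuousOn_const.mul (hF.log hne)).congr fun p hp => hu p.1 hp.1.1 p.2 hp.2
  · exact ((continuousOn_const (c := σ ^ 2 / 2)).mul hq).congr fun p hp =>
      (hasDerivAt_time hu hσ hβ hp.1.1 hp.2).deriv
  · exact (hG.div hF hne).neg.congr fun p hp => dz_eq hu hσ hβ hp.1.1 hp.2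
  · exact (hq.sub ((continuousOn_const (c := β)).mul ((hG.div hF hne).pow 2))).congr fun p hp =>
      dzz_eq hu hσ hβ hp.1.1 hp.2

/-- The logarithm adds `-β (∂_z u)²` to the second space derivative; the quadratic term of the
equation compensates exactly for it. -/
lemma dt_eq_of_eq (hσ : 0 < σ) (hβ : β ≠ 0) {t z : ℝ} (ht : 0 < t) (hz : z ∈ Ici c) :
    dt u t z = σ ^ 2 / 2 * dzz c u t z + β * σ ^ 2 / 2 * dz c u t z ^ 2 := by
  have h : dt u t z = _ := (hasDerivAt_time hu hσ hβ ht hz).deriv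
  rw [h, dzz_eq hu hσ hβ ht hz, dz_eq hu hσ hβ ht hz]
  ring

/-- At `z = c` the first error function vanishes, so the exponential moment equals its tail term. -/
lemma dz_boundary_of_eq (hσ : 0 < σ) (hβ : β ≠ 0) {t : ℝ} (ht : 0 < t) : dz c u t c = -1 := by
  rw [dz_eq hu hσ hβ ht self_mem_Ici]
  have hF := (expMoment_pos hσ β t (le_refl c)).ne'
  have h1 : expMoment β σ c t c = tailTerm β σ c t c := by simp [expMoment, levelArg]
  rw [h1] at hF ⊢
  rw [div_self hF]

end pde

end TargetZone

theorem proposition4 {Ω : Type*} [MeasurableSpace Ω] (P : Measure Ω) [IsProbabilityMeasure P]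
    (W : ℝ≥0 → Ω → ℝ) (hW : IsBrownianReal W P)
    (σ γ κ c T : ℝ) (hσ : 0 < σ) (hγ : 0 < γ) (hκ : 0 < κ) (hT : 0 < T) :
    -- `U` is well defined on the domain and has the closed form in terms of `erf`
    (∀ t ∈ Ioc 0 T, ∀ z ∈ Ici c,
      (∀ᵐ ω ∂P, Tendsto (fun ε => TargetZone.occupation W ((z - c) / σ) t ε ω) (𝓝[>] 0)
        (𝓝 (TargetZone.localTime W ((z - c) / σ) t ω))) ∧
      Integrable (fun ω => Real.exp
        (TargetZone.beta σ γ κ * σ * TargetZone.localTime W ((z - c) / σ) t ω)) P ∧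
      TargetZone.U P W σ γ κ c t z = TargetZone.closedForm σ γ κ c t z) ∧
    -- `U` is of class `C^{1,2}` on `(0, T] × [c, ∞)`
    TargetZone.IsC12 T c (TargetZone.U P W σ γ κ c) ∧
    -- the partial differential equation
    (∀ t ∈ Ioc 0 T, ∀ z ∈ Ici c,
      TargetZone.dt (TargetZone.U P W σ γ κ c) t z =
        σ ^ 2 / 2 * TargetZone.dzz c (TargetZone.U P W σ γ κ c) t z +
          γ ^ 2 / (4 * κ) * TargetZone.dz c (TargetZone.U P W σ γ κ c) t z ^ 2) ∧
    -- the boundary condition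
    (∀ t ∈ Ioc 0 T, TargetZone.dz c (TargetZone.U P W σ γ κ c) t c = -1) := by
  have hβ : 0 < TargetZone.beta σ γ κ := by unfold TargetZone.beta; positivity
  have hmain : ∀ t, 0 < t → ∀ z ∈ Ici c,
      Integrable (fun ω => Real.exp
        (TargetZone.beta σ γ κ * σ * TargetZone.localTime W ((z - c) / σ) t ω)) P ∧
      TargetZone.U P W σ γ κ c t z = 1 / TargetZone.beta σ γ κ *
        Real.log (TargetZone.expMoment (TargetZone.beta σ γ κ) σ c t z) := fun t ht z hz => by
    obtain ⟨h1, h2⟩ := TargetZone.integral_exp_localTime hW ht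
      (mul_pos hβ hσ).le ((z - c) / σ)
    refine ⟨h1, ?_⟩
    rw [TargetZone.U, h2, abs_of_nonneg (div_nonneg (sub_nonneg.2 hz) hσ.le),
      TargetZone.limitMGF_eq_expMoment hσ ht]
  have hu := fun t ht z hz => (hmain t ht z hz).2
  have hcoef : γ ^ 2 / (4 * κ) = TargetZone.beta σ γ κ * σ ^ 2 / 2 := by
    unfold TargetZone.beta
    field_simp
    norm_num
  -- `closedForm` unfolds to the logarithm of `expMoment`, so `hu` also proves the closed form.
  refine ⟨fun t ht z hz => ⟨TargetZone.ae_tendsto_occupation hW ht.1.le _,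
    (hmain t ht.1 z hz).1, hu t ht.1 z hz⟩, TargetZone.isC12_of_eq hu hσ hβ.ne' T,
    fun t ht z hz => ?_, fun t ht => TargetZone.dz_boundary_of_eq hu hσ hβ.ne' ht.1⟩
  rw [hcoef]
  exact TargetZone.dt_eq_of_eq hu hσ hβ.ne' ht.1 hz
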